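/- For $k\ge 1$ let $N(0,I_k)$ be the standard Gaussian distribution on $\mathbb R^k$, let $\theta_k\ge 0$ be the (unique) median of $\|y\|_\infty$ for $y\sim N(0,I_k)$, and let $\mathrm{Cube}_k:\mathbb R^k\to\{-1,1\}$, $\mathrm{Cube}_k(y)=\mathrm{sign}(\theta_k-\|y\|_\infty)$, with the convention $\mathrm{sign}(0)=1$; thus $\mathbb E_{y\sim N(0,I_k)}[\mathrm{Cube}_k(y)]=0$. A measurable function $g:\mathbb R^k\to[-1,1]$ is called $d$-resilient if $\mathbb E_{y\sim N(0,I_k)}[g(y)p(y)]=0$ for every real polynomial $p$ in $k$ variables of total degree at most $d$. For $0\le\alpha<1$, a measurable function $f:\mathbb R^k\to[-1,1]$ is called $\alpha$-approximately $d$-resilient if there is a $d$-resilient $g:\mathbb R^k\to[-1,1]$ with $\mathbb E_{y\sim N(0,I_k)}|f(y)-g(y)|\le\alpha$. **Lemma.** There are an absolute constant $c>0$ and an integer $K$ such that for every integer $k\ge K$ and every integer $d\ge 0$ with $d\le c\,\dfrac{\ln k}{\ln\ln k}$, the function $\mathrm{Cube}_k$ is $\alpha$-approximately $d$-resilient with $\alpha=k^{-0.49}$.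 -/

import Mathlib

open MeasureTheory ProbabilityTheory

noncomputable section

/-- The standard Gaussian distribution `N(0, I_k)` on `ℝ^k`, as the `k`-fold product of the standard
normal law. The norm of the carrier `Fin k → ℝ` is the sup norm. -/
def stdNormal (k : ℕ) : Measure (Fin k → ℝ) :=
  Measure.pi fun _ => gaussianReal 0 1

instance (k : ℕ) : IsProbabilityMeasure (stdNormal k) := by
  unfold stdNormal; infer_instance

/-- `g : ℝ^k → [-1, 1]` is `d`-resilient: it is orthogonal in `L²(N(0, I_k))` to every
polynomial of degree at most `d`. -/
def IsResilient {k : ℕ} (d : ℕ) (g : (Fin k → ℝ) → ℝ) : Prop :=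
  Measurable g ∧ (∀ x, g x ∈ Set.Icc (-1 : ℝ) 1) ∧
    ∀ p : MvPolynomial (Fin k) ℝ, p.totalDegree ≤ d →
      ∫ x, g x * MvPolynomial.eval x p ∂(stdNormal k) = 0

/-- `f : ℝ^k → [-1, 1]` is `α`-approximately `d`-resilient, where `0 ≤ α < 1`: some `d`-resilient
`g : ℝ^k → [-1, 1]` is within `L¹(N(0, I_k))`-distance `α` of `f`. -/
def IsApproxResilient {k : ℕ} (α : ℝ) (d : ℕ) (f : (Fin k → ℝ) → ℝ) : Prop :=
  (0 ≤ α ∧ α < 1) ∧ Measurable f ∧ (∀ x, f x ∈ Set.Icc (-1 : ℝ) 1) ∧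
    ∃ g : (Fin k → ℝ) → ℝ, IsResilient d g ∧ ∫ x, |f x - g x| ∂(stdNormal k) ≤ α

/-- The `{-1, 1}`-valued sign, with `sign 0 = 1`. -/
def pmSign (t : ℝ) : ℝ := if 0 ≤ t then 1 else -1

/-- The threshold `θ_k`: the median of `‖y‖_∞` for `y ∼ N(0, I_k)`. -/
def cubeThreshold (k : ℕ) : ℝ :=
  sInf {t : ℝ | 0 ≤ t ∧ 1 / 2 ≤ (stdNormal k).real {y | ‖y‖ ≤ t}}

/-- The cube function `Cube_k(y) = sign(θ_k - ‖y‖_∞)`. -/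
def cube (k : ℕ) (y : Fin k → ℝ) : ℝ := pmSign (cubeThreshold k - ‖y‖)

/-- The Gaussian mass of the centred cube is a power of the mass of an interval. -/
theorem stdNormal_real_norm_le {k : ℕ} {t : ℝ} (ht : 0 ≤ t) :
    (stdNormal k).real {y | ‖y‖ ≤ t} =
      (∫ x in (-t)..t, gaussianPDFReal 0 1 x) ^ k := by
  have h1 : {y : Fin k → ℝ | ‖y‖ ≤ t} = Set.univ.pi fun _ => Set.Icc (-t) t := by
    ext y
    simp only [Set.mem_pi, Set.mem_univ, true_imp_iff, Set.mem_Icc]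
    exact (pi_norm_le_iff_of_nonneg ht).trans (forall_congr' fun i => abs_le)
  have h2 : (gaussianReal 0 1).real (Set.Icc (-t) t) =
      ∫ x in (-t)..t, gaussianPDFReal 0 1 x := by
    rw [intervalIntegral.integral_of_le (by linarith), ← integral_Icc_eq_integral_Ioc,
      measureReal_def, gaussianReal_apply_eq_integral 0 one_ne_zero, ENNReal.toReal_ofReal]
    exact integral_nonneg fun x => gaussianPDFReal_nonneg 0 1 x
  rw [h1, measureReal_def, stdNormal, Measure.pi_pi, ← h2, measureReal_def]
  simp

theorem interval_gaussian_strictMono {s t : ℝ} (hst : s < t) :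
    ∫ x in (-s)..s, gaussianPDFReal 0 1 x < ∫ x in (-t)..t, gaussianPDFReal 0 1 x := by
  have hi : ∀ a b : ℝ, IntervalIntegrable (gaussianPDFReal 0 1) volume a b := fun a b =>
    (integrable_gaussianPDFReal 0 1).intervalIntegrable
  have hp : ∀ {a b : ℝ}, a < b → 0 < ∫ x in a..b, gaussianPDFReal 0 1 x := fun {a b} hab =>
    intervalIntegral.intervalIntegral_pos_of_pos (hi a b)
      (fun x => gaussianPDFReal_pos 0 1 x one_ne_zero) hab
  have e1 := intervalIntegral.integral_add_adjacent_intervals (hi (-t) (-s)) (hi (-s) s)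
  have e2 := intervalIntegral.integral_add_adjacent_intervals (hi (-t) s) (hi s t)
  have p1 := hp (neg_lt_neg hst)
  have p2 := hp hst
  linarith

/-- For `k ≥ 1`, `θ_k ≥ 0` is exactly the number with `Pr[‖y‖_∞ ≤ θ_k] = 1/2`. -/
theorem cubeThreshold_unique {k : ℕ} (hk : 0 < k) :
    (0 ≤ cubeThreshold k ∧ (stdNormal k).real {y | ‖y‖ ≤ cubeThreshold k} = 1 / 2) ∧
    ∀ t : ℝ, 0 ≤ t → (stdNormal k).real {y | ‖y‖ ≤ t} = 1 / 2 → t = cubeThreshold k := by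
  have hmono : ∀ s t : ℝ, 0 ≤ s → s < t →
      (stdNormal k).real {y | ‖y‖ ≤ s} < (stdNormal k).real {y | ‖y‖ ≤ t} := by
    intro s t hs hst
    rw [stdNormal_real_norm_le hs, stdNormal_real_norm_le (hs.trans hst.le)]
    refine pow_lt_pow_left₀ (interval_gaussian_strictMono hst) ?_ hk.ne'
    exact intervalIntegral.integral_nonneg (by linarith) fun x _ => gaussianPDFReal_nonneg 0 1 x
  have hkey : ∀ t : ℝ, 0 ≤ t → (stdNormal k).real {y | ‖y‖ ≤ t} = 1 / 2 →
      t = cubeThreshold k := by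
    intro t ht h
    have : IsLeast {t : ℝ | 0 ≤ t ∧ 1 / 2 ≤ (stdNormal k).real {y | ‖y‖ ≤ t}} t := by
      refine ⟨⟨ht, h.ge⟩, ?_⟩
      rintro s ⟨hs, hs'⟩
      by_contra! hlt
      have := hmono s t hs hlt
      linarith
    exact this.csInf_eq.symm
  have hcont : Continuous fun t : ℝ => (∫ x in (-t)..t, gaussianPDFReal 0 1 x) ^ k := by
    have hi : ∀ a b : ℝ, IntervalIntegrable (gaussianPDFReal 0 1) volume a b := fun a b =>
      (integrable_gaussianPDFReal 0 1).intervalIntegrable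
    have hG := intervalIntegral.continuous_primitive hi 0
    have e : (fun t : ℝ => ∫ x in (-t)..t, gaussianPDFReal 0 1 x) =
        fun t => (∫ x in (0 : ℝ)..t, gaussianPDFReal 0 1 x) -
          ∫ x in (0 : ℝ)..(-t), gaussianPDFReal 0 1 x := by
      funext t
      rw [intervalIntegral.integral_interval_sub_left (hi _ _) (hi _ _)]
    have : Continuous fun t : ℝ => ∫ x in (-t)..t, gaussianPDFReal 0 1 x := by
      rw [e]
      exact hG.sub (hG.comp continuous_neg)
    exact this.pow k
  obtain ⟨n, hn⟩ : ∃ n : ℕ, 1 / 2 ≤ (stdNormal k).real {y | ‖y‖ ≤ (n : ℝ)} := by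
    have hm : Monotone fun n : ℕ => {y : Fin k → ℝ | ‖y‖ ≤ (n : ℝ)} := by
      intro a b hab y hy
      have hab' : (a : ℝ) ≤ b := by exact_mod_cast hab
      have hy' : ‖y‖ ≤ (a : ℝ) := hy
      exact hy'.trans hab'
    have hU : (⋃ n : ℕ, {y : Fin k → ℝ | ‖y‖ ≤ (n : ℝ)}) = Set.univ := by
      ext y
      simpa using exists_nat_ge ‖y‖
    have ht := tendsto_measure_iUnion_atTop (μ := stdNormal k) hm
    rw [hU, measure_univ] at ht
    have ht' := (ENNReal.tendsto_toReal ENNReal.one_ne_top).comp ht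
    have := ht'.eventually (eventually_ge_nhds (b := 1 / 2) (by norm_num))
    obtain ⟨n, hn⟩ := this.exists
    exact ⟨n, hn⟩
  obtain ⟨t, ht, h⟩ : ∃ t ∈ Set.Icc (0 : ℝ) n,
      (∫ x in (-t)..t, gaussianPDFReal 0 1 x) ^ k = 1 / 2 := by
    refine intermediate_value_Icc n.cast_nonneg hcont.continuousOn ⟨?_, ?_⟩
    · simp [hk.ne']
    · rw [stdNormal_real_norm_le n.cast_nonneg] at hn
      exact hn
  have h' : (stdNormal k).real {y | ‖y‖ ≤ t} = 1 / 2 := by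
    rw [stdNormal_real_norm_le ht.1, h]
  rw [← hkey t ht.1 h']
  exact ⟨⟨ht.1, h'⟩, fun s hs hs' => (hkey s hs hs').trans (hkey t ht.1 h').symm⟩

/-- For `k ≥ 1`, the cube function has Gaussian mean zero. -/
theorem integral_cube {k : ℕ} (hk : 0 < k) : ∫ y, cube k y ∂(stdNormal k) = 0 := by
  have hms : MeasurableSet {y : Fin k → ℝ | ‖y‖ ≤ cubeThreshold k} :=
    measurableSet_le measurable_norm measurable_const
  have e : cube k = fun y => 2 * {y : Fin k → ℝ | ‖y‖ ≤ cubeThreshold k}.indicator 1 y - 1 := by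
    funext y
    by_cases h : ‖y‖ ≤ cubeThreshold k <;> simp [cube, pmSign, h] <;> norm_num
  rw [e, integral_sub, integral_const_mul, integral_indicator_one hms,
    (cubeThreshold_unique hk).1.2]
  · simp
  · exact ((integrable_const (1 : ℝ)).indicator hms).const_mul 2
  · exact integrable_const _

end

/-!
Write `γ` for the standard normal law on `ℝ`, `q = γ[-θ_k, θ_k] = 2 ^ (-1 / k)`, and
`f = cube k = 2 ∏ᵢ 1[|yᵢ| ≤ θ_k] - 1`. It suffices to find a function `F` with
`|F| ≤ ε` everywhere and with the same moments as `f` up to total degree `d`: then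
`g = (f - F) / (1 + ε)` is `[-1, 1]`-valued, orthogonal to low-degree polynomials, and
`|f - g| ≤ 2 ε` (`isApproxResilient_cube_of_moment_match`). Such an `F`, with `ε` about
`k ^ (-0.495)`, is constructed explicitly.

*One variable.* Lagrange interpolation of antiderivatives gives a kernel `κ(x, y)`, bounded in `x`
and of size `(d + 2) ^ O(d + 1) (1 + |y|) ^ d`, with `∫ p(x) κ(x, y) dγ(x) = p(y)` for `deg p ≤ d`
(`exists_isReproducingKernel`). Integrating `κ` against the function `1[|y| ≤ θ_k] - q`, whose
`L¹` norm is at most `2 / k`, gives `s₀` with the same moments up to order `d` and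
`|s₀| ≤ (log k) ^ O(d + 1) / k`. For `d ≤ c log k / log log k` with `c` small and `k` large, this is
at most `k ^ (-1 + δ) / 2` with `δ = 1 / 400`. With `s = s₀ / q`, the function
`G = ∏ᵢ (1 + s(yᵢ)) - 1` has the same low-degree moments as `f`, because `2 q ^ k = 1`.

*Concentration.* The `s(yᵢ)` are independent, bounded by `η = k ^ (-1 + δ)` and of mean zero, so by
Hoeffding's inequality `|∑ᵢ s(yᵢ)| ≤ t = k ^ (-1/2 + 2 δ)`, and hence `|G| ≤ 2 t + 2 k η²`, outside
an event `E` of probability at most `2 exp (-k ^ (2 δ) / 2)`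
(`stdNormal_real_le_abs_sum`, `abs_prod_one_add_sub_one_le`).

*Correction.* On `E` one only knows `|G| ≤ exp (k ^ δ)`. The kernel
`∑_{|S| ≤ d} ∏_{i ∈ S} (κ(xᵢ, yᵢ) - 1)` reproduces polynomials of total degree at most `d` in `k`
variables (`integral_monomial_mul_truncatedKernel`), and has size `exp (O(log² k))` in mean.
Integrating it against `G 1_E` replaces that function by one with the same low-degree moments and
sup norm at most `3 / k` (`exists_bounded_moment_match_prod`, `exceptional_error_le`).
-/

/-! ### A reproducing kernel for polynomials of one variable -/

/-- A bounded-in-`x` kernel `κ x y` which reproduces polynomials of degree at most `d` under the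
standard normal law: `∫ p(x) κ(x, y) dγ(x) = p(y)`. The growth in `y` is controlled by
`A (1 + |y|) ^ d`, uniformly in `x`. -/
structure IsReproducingKernel (d : ℕ) (A : ℝ) (κ : ℝ → ℝ → ℝ) : Prop where
  measurable : Measurable (Function.uncurry κ)
  abs_le : ∀ x y, |κ x y| ≤ A * (1 + |y|) ^ d
  integral_pow_mul : ∀ i ≤ d, ∀ y, ∫ x, x ^ i * κ x y ∂(gaussianReal 0 1) = y ^ i

/-- Differentiating the Lagrange interpolation formula for the monomial `x ^ (i + 1) / (i + 1)`
expresses `y ^ i` through the values of the antiderivative at the nodes. -/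
theorem sum_derivative_lagrange_basis_eval {d i : ℕ} (hi : i ≤ d) {v : ℕ → ℝ}
    (hv : Set.InjOn v (Finset.range (d + 2))) (y : ℝ) :
    ∑ j ∈ Finset.range (d + 2),
      (Polynomial.derivative (Lagrange.basis (Finset.range (d + 2)) v j)).eval y *
        (v j ^ (i + 1) / (i + 1)) = y ^ i := by
  have h := Lagrange.eq_interpolate (s := Finset.range (d + 2)) (v := v)
    (f := (Polynomial.X : Polynomial ℝ) ^ (i + 1)) hv (by
      rw [Polynomial.degree_X_pow, Finset.card_range]
      exact_mod_cast (by omega : i + 1 < d + 2))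
  have h2 := congrArg (fun p => (Polynomial.derivative p).eval y) h
  simp only [Polynomial.derivative_X_pow, Lagrange.interpolate_apply, Polynomial.derivative_sum,
    Polynomial.derivative_C_mul, Polynomial.eval_finsetSum, Polynomial.eval_mul,
    Polynomial.eval_C, Polynomial.eval_pow, Polynomial.eval_X, Nat.add_sub_cancel] at h2
  have hne : (i : ℝ) + 1 ≠ 0 := by positivity
  have h3 : ((i + 1 : ℕ) : ℝ) = (i : ℝ) + 1 := by push_cast; ring
  rw [h3] at h2
  have h4 : y ^ i = (1 / ((i : ℝ) + 1)) * (((i : ℝ) + 1) * y ^ i) := by field_simp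
  rw [h4, h2, Finset.mul_sum]
  refine Finset.sum_congr rfl fun j _ => ?_
  ring

/-- With the equispaced nodes `j / (d + 1)` in `[0, 1]`, the derivatives of the Lagrange basis grow
at most like `(d + 1) ^ (d + 2) (1 + |y|) ^ d`. -/
theorem abs_derivative_lagrange_basis_eval_le {d j : ℕ} (hj : j ∈ Finset.range (d + 2)) (y : ℝ) :
    |(Polynomial.derivative (Lagrange.basis (Finset.range (d + 2))
      (fun i : ℕ => (i : ℝ) / (d + 1)) j)).eval y| ≤ ((d : ℝ) + 1) ^ (d + 2) * (1 + |y|) ^ d := by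
  have hd : (0 : ℝ) < (d : ℝ) + 1 := by positivity
  set v : ℕ → ℝ := fun i => (i : ℝ) / (d + 1) with hv
  have hcard : ((Finset.range (d + 2)).erase j).card = d + 1 := by
    rw [Finset.card_erase_of_mem hj, Finset.card_range]; rfl
  have hinv : ∀ i ∈ (Finset.range (d + 2)).erase j, |(v j - v i)⁻¹| ≤ (d : ℝ) + 1 := by
    intro i hi
    have hij : i ≠ j := Finset.ne_of_mem_erase hi
    have h1 : (1 : ℝ) ≤ |(j : ℝ) - i| := by
      have : (1 : ℤ) ≤ |(j : ℤ) - i| := Int.one_le_abs (by omega)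
      exact_mod_cast this
    have h2 : v j - v i = ((j : ℝ) - i) / (d + 1) := by simp only [hv]; ring
    rw [h2, inv_div, abs_div, abs_of_pos hd]
    exact div_le_self hd.le h1
  have hv1 : ∀ i ∈ (Finset.range (d + 2)).erase j, |y - v i| ≤ 1 + |y| := by
    intro i hi
    have hi' := Finset.mem_range.1 (Finset.mem_of_mem_erase hi)
    have h0 : 0 ≤ v i := by positivity
    have h1 : v i ≤ 1 := by
      simp only [hv]
      rw [div_le_one hd]
      have : i ≤ d + 1 := by omega
      exact_mod_cast this
    rw [abs_le]
    have := neg_abs_le y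
    have := le_abs_self y
    constructor <;> linarith
  have hb : Lagrange.basis (Finset.range (d + 2)) v j =
      ∏ i ∈ (Finset.range (d + 2)).erase j, Polynomial.C (v j - v i)⁻¹ *
        (Polynomial.X - Polynomial.C (v i)) := rfl
  rw [hb, Polynomial.derivative_prod_finset, Polynomial.eval_finsetSum]
  calc |∑ m ∈ (Finset.range (d + 2)).erase j, Polynomial.eval y
        ((∏ i ∈ ((Finset.range (d + 2)).erase j).erase m, Polynomial.C (v j - v i)⁻¹ *
          (Polynomial.X - Polynomial.C (v i))) *
        Polynomial.derivative (Polynomial.C (v j - v m)⁻¹ *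
          (Polynomial.X - Polynomial.C (v m))))|
      ≤ ∑ m ∈ (Finset.range (d + 2)).erase j,
          (((d : ℝ) + 1) * (1 + |y|)) ^ d * ((d : ℝ) + 1) := by
        refine (Finset.abs_sum_le_sum_abs _ _).trans (Finset.sum_le_sum fun m hm => ?_)
        rw [Polynomial.eval_mul, abs_mul, Polynomial.eval_prod, Finset.abs_prod]
        refine mul_le_mul ?_ ?_ (abs_nonneg _) (by positivity)
        · have hc2 : (((Finset.range (d + 2)).erase j).erase m).card = d := by
            rw [Finset.card_erase_of_mem hm, hcard]; rfl
          refine (Finset.prod_le_prod (fun _ _ => abs_nonneg _)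
            (g := fun _ => ((d : ℝ) + 1) * (1 + |y|)) fun i hi => ?_).trans ?_
          · have hi' := Finset.mem_of_mem_erase hi
            simp only [Polynomial.eval_mul, Polynomial.eval_C, Polynomial.eval_sub,
              Polynomial.eval_X, abs_mul]
            exact mul_le_mul (hinv i hi') (hv1 i hi') (abs_nonneg _) hd.le
          · rw [Finset.prod_const, hc2]
        · simpa using hinv m hm
    _ = ((d : ℝ) + 1) ^ (d + 2) * (1 + |y|) ^ d := by
        rw [Finset.sum_const, hcard, nsmul_eq_mul, mul_pow]
        push_cast
        ring

/-- The reciprocal of the standard normal density is at most `5` on `(0, 1]`. -/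
theorem inv_gaussianPDFReal_le_five {x : ℝ} (h0 : 0 ≤ x) (h1 : x ≤ 1) :
    (gaussianPDFReal 0 1 x)⁻¹ ≤ 5 := by
  rw [gaussianPDFReal]
  simp only [NNReal.coe_one, mul_one, sub_zero]
  rw [mul_inv, inv_inv, ← Real.exp_neg]
  have hpi : Real.sqrt (2 * Real.pi) ≤ 2.6 := by
    rw [Real.sqrt_le_left (by norm_num)]
    have := Real.pi_lt_d2
    norm_num
    linarith
  have hx : Real.exp (-(-x ^ 2 / 2)) ≤ 1.7 := by
    have h2 : -(-x ^ 2 / 2) ≤ 1 / 2 := by nlinarith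
    refine (Real.exp_le_exp.2 h2).trans ?_
    have h3 : Real.exp (1 / 2) ^ 2 = Real.exp 1 := by
      rw [← Real.exp_nat_mul]; norm_num
    have h4 := Real.exp_one_lt_d9
    nlinarith [Real.exp_pos (1 / 2)]
  calc _ ≤ (2.6 : ℝ) * 1.7 := mul_le_mul hpi hx (Real.exp_pos _).le (by norm_num)
    _ ≤ 5 := by norm_num

theorem integral_pow_mul_indicator_inv_gaussianPDFReal (i : ℕ) {b : ℝ} (hb : 0 ≤ b) :
    ∫ x, x ^ i * (Set.Ioc 0 b).indicator (fun x => (gaussianPDFReal 0 1 x)⁻¹) x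
      ∂(gaussianReal 0 1) = b ^ (i + 1) / (i + 1) := by
  rw [integral_gaussianReal_eq_integral_smul one_ne_zero]
  have : (fun x => gaussianPDFReal 0 1 x • (x ^ i *
      (Set.Ioc 0 b).indicator (fun x => (gaussianPDFReal 0 1 x)⁻¹) x)) =
      (Set.Ioc 0 b).indicator fun x => x ^ i := by
    funext x
    by_cases hx : x ∈ Set.Ioc 0 b
    · have := (gaussianPDFReal_pos 0 1 x one_ne_zero).ne'
      simp only [Set.indicator_of_mem hx, smul_eq_mul]
      field_simp
    · simp [Set.indicator_of_notMem hx]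
  rw [this, integral_indicator measurableSet_Ioc, ← intervalIntegral.integral_of_le hb,
    integral_pow]
  simp

/-- The kernel is `κ(x, y) = ∑ⱼ Lⱼ'(y) 1_{(0, vⱼ]}(x) / φ(x)`, with `φ` the normal density and `Lⱼ`
the Lagrange basis at the nodes `vⱼ = j / (d + 1)`. -/
theorem exists_isReproducingKernel (d : ℕ) :
    ∃ κ, IsReproducingKernel d (5 * ((d : ℝ) + 2) ^ (d + 3)) κ := by
  have hd : (0 : ℝ) < (d : ℝ) + 1 := by positivity
  set v : ℕ → ℝ := fun i => (i : ℝ) / (d + 1) with hv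
  set ℓ : ℕ → Polynomial ℝ := fun j =>
    Polynomial.derivative (Lagrange.basis (Finset.range (d + 2)) v j) with hℓ
  set φ : ℕ → ℝ → ℝ := fun j =>
    (Set.Ioc 0 (v j)).indicator (fun x => (gaussianPDFReal 0 1 x)⁻¹) with hφ
  have hv0 : ∀ j, 0 ≤ v j := fun j => by positivity
  have hφm : ∀ j, Measurable (φ j) := fun j =>
    ((measurable_gaussianPDFReal 0 1).inv).indicator measurableSet_Ioc
  have hφb : ∀ j ∈ Finset.range (d + 2), ∀ x, |φ j x| ≤ 5 := by
    intro j hj x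
    have hv1 : v j ≤ 1 := by
      simp only [hv]
      rw [div_le_one hd]
      have := Finset.mem_range.1 hj
      have : j ≤ d + 1 := by omega
      exact_mod_cast this
    by_cases hx : x ∈ Set.Ioc 0 (v j)
    · simp only [hφ, Set.indicator_of_mem hx]
      rw [abs_of_nonneg (inv_nonneg.2 (gaussianPDFReal_nonneg 0 1 x))]
      exact inv_gaussianPDFReal_le_five hx.1.le (hx.2.trans hv1)
    · simp [hφ, Set.indicator_of_notMem hx]
  have hvi : Set.InjOn v (Finset.range (d + 2)) := by
    intro a _ b _ hab
    simp only [hv] at hab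
    rw [div_left_inj' hd.ne'] at hab
    exact_mod_cast hab
  refine ⟨fun x y => ∑ j ∈ Finset.range (d + 2), (ℓ j).eval y * φ j x, ?_, ?_, ?_⟩
  · refine Finset.measurable_sum _ fun j _ => ?_
    exact ((Polynomial.continuous _).measurable.comp measurable_snd).mul
      ((hφm j).comp measurable_fst)
  · intro x y
    calc |∑ j ∈ Finset.range (d + 2), (ℓ j).eval y * φ j x|
        ≤ ∑ j ∈ Finset.range (d + 2), (((d : ℝ) + 1) ^ (d + 2) * (1 + |y|) ^ d) * 5 := by
          refine (Finset.abs_sum_le_sum_abs _ _).trans (Finset.sum_le_sum fun j hj => ?_)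
          rw [abs_mul]
          exact mul_le_mul (abs_derivative_lagrange_basis_eval_le hj y) (hφb j hj x)
            (abs_nonneg _) (by positivity)
      _ = 5 * (((d : ℝ) + 2) * ((d : ℝ) + 1) ^ (d + 2)) * (1 + |y|) ^ d := by
          rw [Finset.sum_const, Finset.card_range, nsmul_eq_mul]
          push_cast
          ring
      _ ≤ 5 * ((d : ℝ) + 2) ^ (d + 3) * (1 + |y|) ^ d := by
          have h1 : ((d : ℝ) + 1) ^ (d + 2) ≤ ((d : ℝ) + 2) ^ (d + 2) :=
            pow_le_pow_left₀ hd.le (by linarith) _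
          have h2 : ((d : ℝ) + 2) ^ (d + 3) = ((d : ℝ) + 2) * ((d : ℝ) + 2) ^ (d + 2) := by ring
          rw [h2]
          gcongr
  · intro i hi y
    simp only [Finset.mul_sum]
    rw [integral_finsetSum]
    · rw [← sum_derivative_lagrange_basis_eval hi hvi y]
      refine Finset.sum_congr rfl fun j _ => ?_
      rw [← integral_pow_mul_indicator_inv_gaussianPDFReal i (hv0 j), ← integral_const_mul]
      refine integral_congr_ae (Filter.Eventually.of_forall fun x => ?_)
      simp only [hφ, hℓ]
      ring
    · intro j hj
      have hbd : ∀ x, |x ^ i * ((ℓ j).eval y * φ j x)| ≤ |(ℓ j).eval y| * 5 := by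
        intro x
        have hv1 : v j ≤ 1 := by
          simp only [hv]
          rw [div_le_one hd]
          have := Finset.mem_range.1 hj
          have : j ≤ d + 1 := by omega
          exact_mod_cast this
        by_cases hx : x ∈ Set.Ioc 0 (v j)
        · have hx1 : |x ^ i| ≤ 1 := by
            rw [abs_pow, abs_of_pos hx.1]
            exact pow_le_one₀ hx.1.le (hx.2.trans hv1)
          rw [abs_mul, abs_mul]
          calc |x ^ i| * (|(ℓ j).eval y| * |φ j x|) ≤ 1 * (|(ℓ j).eval y| * 5) := by
                gcongr
                exact hφb j hj x
            _ = _ := one_mul _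
        · simp only [hφ, Set.indicator_of_notMem hx, mul_zero, abs_zero]
          positivity
      refine Integrable.of_bound (C := |(ℓ j).eval y| * 5) ?_
        (Filter.Eventually.of_forall fun x => by simpa using hbd x)
      exact ((measurable_id.pow_const i).mul ((hφm j).const_mul _)).aestronglyMeasurable

/-! ### Gaussian moments -/

theorem integrable_exp_two_mul_one_add_abs :
    Integrable (fun y : ℝ => Real.exp (2 * (1 + |y|))) (gaussianReal 0 1) := by
  have h : Integrable (fun y : ℝ => Real.exp (2 * |y|)) (gaussianReal 0 1) :=
    integrable_exp_mul_abs (X := fun y : ℝ => y) (integrable_exp_mul_gaussianReal 2)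
      (integrable_exp_mul_gaussianReal (-2))
  refine (h.const_mul (Real.exp 2)).congr (Filter.Eventually.of_forall fun y => ?_)
  simp only
  rw [← Real.exp_add]
  ring_nf

/-- The exponential moment `E exp (2 (1 + |y|))` of a standard normal `y`. -/
noncomputable def gaussianExpMoment : ℝ := ∫ y, Real.exp (2 * (1 + |y|)) ∂(gaussianReal 0 1)

theorem one_le_gaussianExpMoment : 1 ≤ gaussianExpMoment := by
  have h : ∫ _ : ℝ, (1 : ℝ) ∂(gaussianReal 0 1) ≤ gaussianExpMoment := by
    refine integral_mono (integrable_const _) integrable_exp_two_mul_one_add_abs fun y => ?_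
    exact Real.one_le_exp (by positivity)
  simpa using h

theorem pow_le_factorial_mul_exp {z : ℝ} (hz : 0 ≤ z) (d : ℕ) :
    z ^ d ≤ (d.factorial : ℝ) * Real.exp z := by
  have := Real.pow_div_factorial_le_exp z hz d
  rwa [div_le_iff₀ (by positivity), mul_comm] at this

theorem integrable_one_add_abs_pow (d : ℕ) :
    Integrable (fun y : ℝ => (1 + |y|) ^ d) (gaussianReal 0 1) := by
  refine (integrable_exp_two_mul_one_add_abs.const_mul (d.factorial : ℝ)).mono'
    (by fun_prop) (Filter.Eventually.of_forall fun y => ?_)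
  have h0 : 0 ≤ 1 + |y| := by positivity
  rw [Real.norm_of_nonneg (by positivity)]
  refine (pow_le_factorial_mul_exp h0 d).trans ?_
  gcongr
  linarith

/-- A function that is small in `L¹(γ)` and bounded by `1` has a small integral against
`(1 + |y|) ^ d`: below the level `L` the weight is at most `L ^ d`, above it the Gaussian tail
wins. -/
theorem integral_abs_mul_one_add_abs_pow_le {w : ℝ → ℝ} (hw : Measurable w) (hb : ∀ y, |w y| ≤ 1)
    (d : ℕ) {L : ℝ} (hL : 0 ≤ L) :
    ∫ y, |w y| * (1 + |y|) ^ d ∂(gaussianReal 0 1) ≤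
      L ^ d * ∫ y, |w y| ∂(gaussianReal 0 1) +
        d.factorial * gaussianExpMoment * Real.exp (-L) := by
  have hwi : Integrable (fun y => |w y|) (gaussianReal 0 1) :=
    Integrable.of_bound (C := 1) hw.abs.aestronglyMeasurable
      (Filter.Eventually.of_forall fun y => by simpa using hb y)
  have hr : Integrable (fun y => L ^ d * |w y| +
      (d.factorial * Real.exp (-L)) * Real.exp (2 * (1 + |y|))) (gaussianReal 0 1) :=
    (hwi.const_mul _).add (integrable_exp_two_mul_one_add_abs.const_mul _)
  have hpt : ∀ y, |w y| * (1 + |y|) ^ d ≤ L ^ d * |w y| +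
      (d.factorial * Real.exp (-L)) * Real.exp (2 * (1 + |y|)) := by
    intro y
    have h0 : 0 ≤ 1 + |y| := by positivity
    rcases le_total (1 + |y|) L with h | h
    · have h1 : (1 + |y|) ^ d ≤ L ^ d := pow_le_pow_left₀ h0 h d
      have h2 : |w y| * (1 + |y|) ^ d ≤ |w y| * L ^ d := by gcongr
      have h3 : 0 ≤ (d.factorial * Real.exp (-L)) * Real.exp (2 * (1 + |y|)) := by positivity
      linarith
    · have h1 : (1 + |y|) ^ d ≤ (d.factorial * Real.exp (-L)) * Real.exp (2 * (1 + |y|)) := by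
        refine (pow_le_factorial_mul_exp h0 d).trans ?_
        rw [mul_assoc, ← Real.exp_add]
        exact mul_le_mul_of_nonneg_left (Real.exp_le_exp.2 (by linarith)) (by positivity)
      have h2 : |w y| * (1 + |y|) ^ d ≤ 1 * (1 + |y|) ^ d := by
        gcongr
        exact hb y
      have h3 : 0 ≤ L ^ d * |w y| := by positivity
      linarith
  refine (integral_mono (hr.mono' (by fun_prop) (Filter.Eventually.of_forall fun y => ?_)) hr
    hpt).trans ?_
  · rw [Real.norm_of_nonneg (by positivity)]
    exact hpt y
  · rw [integral_add (hwi.const_mul _) (integrable_exp_two_mul_one_add_abs.const_mul _),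
      integral_const_mul, integral_const_mul, gaussianExpMoment]
    linarith

theorem integral_mul_one_add_abs_pow_add_one_sq_le {A : ℝ} (hA : 1 ≤ A) (d : ℕ) :
    Integrable (fun y : ℝ => (A * (1 + |y|) ^ d + 1) ^ 2) (gaussianReal 0 1) ∧
    ∫ y, (A * (1 + |y|) ^ d + 1) ^ 2 ∂(gaussianReal 0 1) ≤
      (2 * A * d.factorial) ^ 2 * gaussianExpMoment := by
  have hpt : ∀ y : ℝ, (A * (1 + |y|) ^ d + 1) ^ 2 ≤
      (2 * A * d.factorial) ^ 2 * Real.exp (2 * (1 + |y|)) := by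
    intro y
    have h0 : 0 ≤ 1 + |y| := by positivity
    have h1 := pow_le_factorial_mul_exp h0 d
    have h2 : (1 : ℝ) ≤ (1 + |y|) ^ d := one_le_pow₀ (by linarith [abs_nonneg y])
    have h3 : A * (1 + |y|) ^ d + 1 ≤ 2 * A * d.factorial * Real.exp (1 + |y|) := by
      have : (1 : ℝ) ≤ A * (1 + |y|) ^ d := one_le_mul_of_one_le_of_one_le hA h2
      have h4 : A * (1 + |y|) ^ d ≤ A * (d.factorial * Real.exp (1 + |y|)) := by gcongr
      linarith
    calc (A * (1 + |y|) ^ d + 1) ^ 2 ≤ (2 * A * d.factorial * Real.exp (1 + |y|)) ^ 2 :=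
          pow_le_pow_left₀ (by positivity) h3 2
      _ = _ := by rw [mul_pow, ← Real.exp_nat_mul]; norm_num
  have hr : Integrable (fun y => (2 * A * d.factorial) ^ 2 * Real.exp (2 * (1 + |y|)))
      (gaussianReal 0 1) := integrable_exp_two_mul_one_add_abs.const_mul _
  have hi : Integrable (fun y : ℝ => (A * (1 + |y|) ^ d + 1) ^ 2) (gaussianReal 0 1) :=
    hr.mono' (by fun_prop) (Filter.Eventually.of_forall fun y => by
      rw [Real.norm_of_nonneg (by positivity)]
      exact hpt y)
  refine ⟨hi, (integral_mono hi hr hpt).trans ?_⟩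
  rw [integral_const_mul, gaussianExpMoment]

theorem integrable_abs_pow_gaussian (i : ℕ) :
    Integrable (fun x : ℝ => |x| ^ i) (gaussianReal 0 1) := by
  refine (integrable_one_add_abs_pow i).mono' (by fun_prop)
    (Filter.Eventually.of_forall fun y => ?_)
  rw [Real.norm_of_nonneg (by positivity)]
  gcongr
  linarith

/-- Integrating a reproducing kernel against `w` produces a bounded function with the same moments
as `w` up to order `d`. -/
theorem IsReproducingKernel.exists_bounded_moment_match {d : ℕ} {A : ℝ} {κ : ℝ → ℝ → ℝ}
    (hκ : IsReproducingKernel d A κ) {w : ℝ → ℝ} (hw : Measurable w) (hb : ∀ y, |w y| ≤ 1) :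
    ∃ s : ℝ → ℝ, Measurable s ∧
      (∀ x, |s x| ≤ A * ∫ y, |w y| * (1 + |y|) ^ d ∂(gaussianReal 0 1)) ∧
      ∀ i ≤ d, ∫ x, x ^ i * s x ∂(gaussianReal 0 1) = ∫ x, x ^ i * w x ∂(gaussianReal 0 1) := by
  have hm2 : Measurable (Function.uncurry fun x y => κ x y * w y) :=
    hκ.measurable.mul (hw.comp measurable_snd)
  have hdom : Integrable (fun y => |w y| * (1 + |y|) ^ d) (gaussianReal 0 1) := by
    refine (integrable_one_add_abs_pow d).mono' (by fun_prop)
      (Filter.Eventually.of_forall fun y => ?_)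
    rw [Real.norm_of_nonneg (by positivity)]
    exact mul_le_of_le_one_left (by positivity) (hb y)
  have hle : ∀ x y, ‖κ x y * w y‖ ≤ A * (|w y| * (1 + |y|) ^ d) := by
    intro x y
    rw [norm_mul, Real.norm_eq_abs, Real.norm_eq_abs]
    have := mul_le_mul_of_nonneg_right (hκ.abs_le x y) (abs_nonneg (w y))
    linarith
  refine ⟨fun x => ∫ y, κ x y * w y ∂(gaussianReal 0 1), ?_, ?_, ?_⟩
  · exact (hm2.stronglyMeasurable.integral_prod_right).measurable
  · intro x
    rw [← integral_const_mul, ← Real.norm_eq_abs]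
    exact norm_integral_le_of_norm_le (hdom.const_mul A) (Filter.Eventually.of_forall (hle x))
  · intro i hi
    simp_rw [← integral_const_mul]
    rw [integral_integral_swap]
    · refine integral_congr_ae (Filter.Eventually.of_forall fun y => ?_)
      simp only
      rw [← hκ.integral_pow_mul i hi y, ← integral_mul_const]
      simp only [mul_assoc]
    · refine ((integrable_abs_pow_gaussian i).mul_prod (hdom.const_mul A)).mono' ?_
        (Filter.Eventually.of_forall fun p => ?_)
      · exact ((measurable_fst.pow_const i).mul hm2).aestronglyMeasurable
      · simp only [Function.uncurry]
        rw [norm_mul, norm_pow, Real.norm_eq_abs]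
        exact mul_le_mul_of_nonneg_left (hle _ _) (by positivity)

/-! ### A reproducing kernel for polynomials of bounded total degree -/

section TruncatedKernel

variable {k : ℕ}

theorem integral_stdNormal_prod (f : Fin k → ℝ → ℝ) :
    ∫ x, ∏ i, f i (x i) ∂(stdNormal k) = ∏ i, ∫ x, f i x ∂(gaussianReal 0 1) :=
  integral_fintype_prod_eq_prod f

theorem integrable_stdNormal_prod {f : Fin k → ℝ → ℝ}
    (hf : ∀ i, Integrable (f i) (gaussianReal 0 1)) :
    Integrable (fun x => ∏ i, f i (x i)) (stdNormal k) :=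
  Integrable.fintype_prod hf

theorem integrable_abs_monomial (a : Fin k → ℕ) :
    Integrable (fun x : Fin k → ℝ => ∏ i, |x i| ^ a i) (stdNormal k) :=
  integrable_stdNormal_prod fun i => integrable_abs_pow_gaussian (a i)

theorem integrable_mul_monomial {h : (Fin k → ℝ) → ℝ} (hm : Measurable h) {C : ℝ}
    (hb : ∀ x, |h x| ≤ C) (a : Fin k → ℕ) :
    Integrable (fun x => h x * ∏ i, x i ^ a i) (stdNormal k) := by
  refine ((integrable_abs_monomial a).const_mul C).mono' (by fun_prop)
    (Filter.Eventually.of_forall fun x => ?_)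
  rw [norm_mul, Real.norm_eq_abs, Real.norm_eq_abs, Finset.abs_prod]
  simp only [abs_pow]
  exact mul_le_mul_of_nonneg_right (hb x) (by positivity)

/-- It is enough to test orthogonality to low-degree polynomials on monomials. -/
theorem integral_mul_eval_eq_zero_of_monomial {h : (Fin k → ℝ) → ℝ} (hm : Measurable h) {C : ℝ}
    (hb : ∀ x, |h x| ≤ C) {d : ℕ}
    (h0 : ∀ a : Fin k → ℕ, ∑ i, a i ≤ d → ∫ x, h x * ∏ i, x i ^ a i ∂(stdNormal k) = 0)
    (p : MvPolynomial (Fin k) ℝ) (hp : p.totalDegree ≤ d) :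
    ∫ x, h x * MvPolynomial.eval x p ∂(stdNormal k) = 0 := by
  simp only [MvPolynomial.eval_eq', Finset.mul_sum]
  rw [integral_finsetSum]
  · refine Finset.sum_eq_zero fun a ha => ?_
    have hd : ∑ i, a i ≤ d := by
      have := (MvPolynomial.le_totalDegree ha).trans hp
      rwa [Finsupp.sum_fintype _ _ (fun _ => rfl)] at this
    have := h0 a hd
    calc _ = ∫ x, MvPolynomial.coeff a p * (h x * ∏ i, x i ^ a i) ∂(stdNormal k) := by
          congr 1
          funext x
          ring
      _ = 0 := by rw [integral_const_mul, this, mul_zero]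
  · intro a _
    refine ((integrable_mul_monomial hm hb a).const_mul (MvPolynomial.coeff a p)).congr
      (Filter.Eventually.of_forall fun x => ?_)
    simp only
    ring

/-- The `k`-variable kernel `∑_{|S| ≤ d} ∏_{i ∈ S} (κ(xᵢ, yᵢ) - 1)`. The full sum over all `S` would
be the product kernel `∏ᵢ κ(xᵢ, yᵢ)`; the truncation keeps the reproducing property for total
degree at most `d`, and its size grows with `k` only like `k ^ d`. -/
noncomputable def truncatedKernel (d : ℕ) (κ : ℝ → ℝ → ℝ) (x y : Fin k → ℝ) : ℝ :=
  ∑ S ∈ (Finset.univ : Finset (Finset (Fin k))).filter (fun S => S.card ≤ d),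
    ∏ i ∈ S, (κ (x i) (y i) - 1)

/-- The bound for `truncatedKernel d κ x y`, uniform in `x`, given by
`|κ(x, y) - 1| ≤ A (1 + |y|) ^ d + 1`. -/
noncomputable def kernelBound (d : ℕ) (A : ℝ) (y : Fin k → ℝ) : ℝ :=
  ∑ S ∈ (Finset.univ : Finset (Finset (Fin k))).filter (fun S => S.card ≤ d),
    ∏ i ∈ S, (A * (1 + |y i|) ^ d + 1)

variable {d : ℕ} {A : ℝ} {κ : ℝ → ℝ → ℝ}

theorem measurable_truncatedKernel (hκ : IsReproducingKernel d A κ) :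
    Measurable (Function.uncurry (truncatedKernel (k := k) d κ)) := by
  unfold truncatedKernel
  refine Finset.measurable_sum _ fun S _ => Finset.measurable_prod _ fun i _ => ?_
  have h1 : Measurable fun p : (Fin k → ℝ) × (Fin k → ℝ) => (p.1 i, p.2 i) := by fun_prop
  exact (hκ.measurable.comp h1).sub_const 1

theorem abs_truncatedKernel_le (hκ : IsReproducingKernel d A κ) (x y : Fin k → ℝ) :
    |truncatedKernel d κ x y| ≤ kernelBound d A y := by
  refine (Finset.abs_sum_le_sum_abs _ _).trans (Finset.sum_le_sum fun S _ => ?_)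
  rw [Finset.abs_prod]
  refine Finset.prod_le_prod (fun _ _ => abs_nonneg _) fun i _ => ?_
  have h1 := hκ.abs_le (x i) (y i)
  have h2 := abs_sub (κ (x i) (y i)) 1
  rw [abs_one] at h2
  linarith

theorem integrable_prod_finset_kernelBound (A : ℝ) (d : ℕ) (S : Finset (Fin k)) :
    Integrable (fun y : Fin k → ℝ => ∏ i ∈ S, (A * (1 + |y i|) ^ d + 1)) (stdNormal k) := by
  have h := integrable_stdNormal_prod (k := k)
    (f := fun i t => if i ∈ S then A * (1 + |t|) ^ d + 1 else 1) (fun i => by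
      by_cases hi : i ∈ S
      · simp only [hi, if_true]
        exact ((integrable_one_add_abs_pow d).const_mul A).add (integrable_const _)
      · simp only [hi, if_false]
        exact integrable_const _)
  refine h.congr (Filter.Eventually.of_forall fun y => ?_)
  simp only
  rw [Finset.prod_ite_mem, Finset.univ_inter]

theorem integrable_kernelBound (A : ℝ) (d : ℕ) :
    Integrable (kernelBound (k := k) d A) (stdNormal k) :=
  integrable_finsetSum _ fun S _ => integrable_prod_finset_kernelBound A d S

theorem IsReproducingKernel.integrable_left (hκ : IsReproducingKernel d A κ) (i : ℕ) (y : ℝ) :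
    Integrable (fun x => x ^ i * κ x y) (gaussianReal 0 1) := by
  have hm : Measurable fun x => κ x y := hκ.measurable.comp (measurable_id.prodMk measurable_const)
  refine ((integrable_abs_pow_gaussian i).mul_const (A * (1 + |y|) ^ d)).mono'
    ((measurable_id.pow_const i).mul hm).aestronglyMeasurable
    (Filter.Eventually.of_forall fun x => ?_)
  rw [norm_mul, norm_pow, Real.norm_eq_abs, Real.norm_eq_abs]
  exact mul_le_mul_of_nonneg_left (hκ.abs_le x y) (by positivity)

theorem integrable_pow_gaussian (i : ℕ) :
    Integrable (fun x : ℝ => x ^ i) (gaussianReal 0 1) :=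
  (integrable_abs_pow_gaussian i).mono' (by fun_prop) (Filter.Eventually.of_forall fun x => by
    rw [norm_pow, Real.norm_eq_abs])

theorem integral_monomial_mul_prod_kernel (hκ : IsReproducingKernel d A κ) {a : Fin k → ℕ}
    (ha : ∀ i, a i ≤ d) (S : Finset (Fin k)) (y : Fin k → ℝ) :
    ∫ x, (∏ i, x i ^ a i) * ∏ i ∈ S, (κ (x i) (y i) - 1) ∂(stdNormal k) =
      (∏ i ∈ S, (y i ^ a i - ∫ t, t ^ a i ∂(gaussianReal 0 1))) *
        ∏ i ∈ Finset.univ \ S, ∫ t, t ^ a i ∂(gaussianReal 0 1) := by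
  calc _ = ∫ x, ∏ i, (fun t => if i ∈ S then t ^ a i * κ t (y i) - t ^ a i else t ^ a i) (x i)
        ∂(stdNormal k) := by
        congr 1
        funext x
        rw [← Finset.univ_inter S, ← Finset.prod_ite_mem, ← Finset.prod_mul_distrib]
        refine Finset.prod_congr rfl fun i _ => ?_
        simp only [Finset.univ_inter]
        split_ifs <;> ring
    _ = ∏ i, if i ∈ S then y i ^ a i - ∫ t, t ^ a i ∂(gaussianReal 0 1)
          else ∫ t, t ^ a i ∂(gaussianReal 0 1) := by
        refine (integral_stdNormal_prod fun i t =>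
          if i ∈ S then t ^ a i * κ t (y i) - t ^ a i else t ^ a i).trans ?_
        refine Finset.prod_congr rfl fun i _ => ?_
        by_cases hi : i ∈ S
        · simp only [hi, if_true]
          rw [integral_sub (hκ.integrable_left _ _) (integrable_pow_gaussian _),
            hκ.integral_pow_mul _ (ha i)]
        · simp only [hi, if_false]
    _ = _ := by
        rw [Finset.prod_ite]
        congr 1
        · exact Finset.prod_congr (by ext; simp) fun _ _ => rfl
        · exact Finset.prod_congr (by ext; simp) fun _ _ => rfl

theorem integrable_monomial_mul_prod_kernel (hκ : IsReproducingKernel d A κ) (a : Fin k → ℕ)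
    (S : Finset (Fin k)) (y : Fin k → ℝ) :
    Integrable (fun x : Fin k → ℝ => (∏ i, x i ^ a i) * ∏ i ∈ S, (κ (x i) (y i) - 1))
      (stdNormal k) := by
  have h := integrable_stdNormal_prod (k := k)
    (f := fun i t => if i ∈ S then t ^ a i * κ t (y i) - t ^ a i else t ^ a i) (fun i => by
      by_cases hi : i ∈ S
      · simp only [hi, if_true]
        exact (hκ.integrable_left _ _).sub (integrable_pow_gaussian _)
      · simp only [hi, if_false]
        exact integrable_pow_gaussian _)
  refine h.congr (Filter.Eventually.of_forall fun x => ?_)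
  simp only
  rw [← Finset.univ_inter S, ← Finset.prod_ite_mem, ← Finset.prod_mul_distrib]
  refine Finset.prod_congr rfl fun i _ => ?_
  simp only [Finset.univ_inter]
  split_ifs <;> ring

/-- The truncated kernel reproduces monomials of total degree at most `d`: a set `S` that is not
contained in the support of the monomial contributes zero, so the truncation loses nothing. -/
theorem integral_monomial_mul_truncatedKernel (hκ : IsReproducingKernel d A κ) {a : Fin k → ℕ}
    (ha : ∑ i, a i ≤ d) (y : Fin k → ℝ) :
    ∫ x, (∏ i, x i ^ a i) * truncatedKernel d κ x y ∂(stdNormal k) = ∏ i, y i ^ a i := by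
  have hai : ∀ i, a i ≤ d := fun i =>
    (Finset.single_le_sum (fun _ _ => Nat.zero_le _) (Finset.mem_univ i)).trans ha
  simp only [truncatedKernel, Finset.mul_sum]
  rw [integral_finsetSum _ fun S _ => integrable_monomial_mul_prod_kernel hκ a S y]
  simp only [integral_monomial_mul_prod_kernel hκ hai]
  have hexp := Finset.prod_add (fun i => y i ^ a i - ∫ t, t ^ a i ∂(gaussianReal 0 1))
    (fun i => ∫ t, t ^ a i ∂(gaussianReal 0 1)) (Finset.univ : Finset (Fin k))
  simp only [sub_add_cancel, Finset.powerset_univ] at hexp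
  rw [hexp]
  refine Finset.sum_subset (Finset.filter_subset _ _) fun S _ hS => ?_
  simp only [Finset.mem_filter, Finset.mem_univ, true_and, not_le] at hS
  obtain ⟨i, hiS, hi0⟩ : ∃ i ∈ S, a i = 0 := by
    by_contra! hne
    have h1 : S.card ≤ ∑ i ∈ S, a i := by
      rw [Finset.card_eq_sum_ones]
      exact Finset.sum_le_sum fun i hi => Nat.one_le_iff_ne_zero.2 (hne i hi)
    have h2 : ∑ i ∈ S, a i ≤ ∑ i, a i :=
      Finset.sum_le_sum_of_subset (Finset.subset_univ S)
    omega
  rw [Finset.prod_eq_zero hiS, zero_mul]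
  simp [hi0]

/-- Any bounded function `R` on `ℝ^k` has the same moments up to total degree `d` as a function
bounded by `E (|R| B)`, where `B` is `kernelBound`. -/
theorem IsReproducingKernel.exists_bounded_moment_match_pi (hκ : IsReproducingKernel d A κ)
    {R : (Fin k → ℝ) → ℝ} (hR : Measurable R) {C : ℝ} (hC : ∀ y, |R y| ≤ C) :
    ∃ F : (Fin k → ℝ) → ℝ, Measurable F ∧
      (∀ x, |F x| ≤ ∫ y, |R y| * kernelBound d A y ∂(stdNormal k)) ∧
      ∀ a : Fin k → ℕ, ∑ i, a i ≤ d →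
        ∫ x, F x * ∏ i, x i ^ a i ∂(stdNormal k) = ∫ x, R x * ∏ i, x i ^ a i ∂(stdNormal k) := by
  have hm2 : Measurable (Function.uncurry fun x y => truncatedKernel (k := k) d κ x y * R y) :=
    (measurable_truncatedKernel hκ).mul (hR.comp measurable_snd)
  have hB0 : ∀ y : Fin k → ℝ, 0 ≤ kernelBound d A y := fun y =>
    (abs_nonneg _).trans (abs_truncatedKernel_le hκ 0 y)
  have hBi : Integrable (kernelBound (k := k) d A) (stdNormal k) := integrable_kernelBound A d
  have hdom : Integrable (fun y => |R y| * kernelBound d A y) (stdNormal k) := by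
    refine (hBi.const_mul C).mono'
      (hR.abs.aestronglyMeasurable.mul hBi.aestronglyMeasurable)
      (Filter.Eventually.of_forall fun y => ?_)
    rw [Real.norm_of_nonneg (mul_nonneg (abs_nonneg _) (hB0 y))]
    exact mul_le_mul_of_nonneg_right (hC y) (hB0 y)
  have hle : ∀ x y, ‖truncatedKernel d κ x y * R y‖ ≤ |R y| * kernelBound d A y := by
    intro x y
    rw [norm_mul, Real.norm_eq_abs, Real.norm_eq_abs, mul_comm]
    exact mul_le_mul_of_nonneg_left (abs_truncatedKernel_le hκ x y) (abs_nonneg _)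
  refine ⟨fun x => ∫ y, truncatedKernel d κ x y * R y ∂(stdNormal k), ?_, ?_, ?_⟩
  · exact (hm2.stronglyMeasurable.integral_prod_right).measurable
  · intro x
    rw [← Real.norm_eq_abs]
    exact norm_integral_le_of_norm_le hdom (Filter.Eventually.of_forall (hle x))
  · intro a ha
    simp_rw [← integral_mul_const]
    rw [integral_integral_swap]
    · refine integral_congr_ae (Filter.Eventually.of_forall fun y => ?_)
      simp only
      rw [← integral_monomial_mul_truncatedKernel hκ ha y, ← integral_const_mul]
      congr 1
      funext x
      ring
    · refine ((integrable_abs_monomial a).mul_prod hdom).mono' ?_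
        (Filter.Eventually.of_forall fun p => ?_)
      · have h3 : Measurable fun p : (Fin k → ℝ) × (Fin k → ℝ) => ∏ i, p.1 i ^ a i := by fun_prop
        exact (hm2.mul h3).aestronglyMeasurable
      · simp only [Function.uncurry]
        rw [norm_mul, mul_comm, Real.norm_eq_abs (∏ i, _), Finset.abs_prod]
        simp only [abs_pow]
        exact mul_le_mul_of_nonneg_left (hle _ _) (by positivity)

end TruncatedKernel

/-! ### Products of independent factors close to one -/

section Products

variable {k : ℕ}

/-- Hoeffding's inequality for `∑ᵢ s(yᵢ)`, two-sided. -/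
theorem stdNormal_real_le_abs_sum {s : ℝ → ℝ} (hs : Measurable s) {η : ℝ} (hη : ∀ x, |s x| ≤ η)
    (h0 : ∫ x, s x ∂(gaussianReal 0 1) = 0) {t : ℝ} (ht : 0 ≤ t) :
    (stdNormal k).real {y | t ≤ |∑ i, s (y i)|} ≤ 2 * Real.exp (-t ^ 2 / (2 * (k * η ^ 2))) := by
  have one_sided : ∀ r : ℝ → ℝ, Measurable r → (∀ x, |r x| ≤ η) →
      ∫ x, r x ∂(gaussianReal 0 1) = 0 →
      (stdNormal k).real {y | t ≤ ∑ i, r (y i)} ≤ Real.exp (-t ^ 2 / (2 * (k * η ^ 2))) := by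
    intro r hr hrη hr0
    have hind : iIndepFun (fun (i : Fin k) (y : Fin k → ℝ) => r (y i)) (stdNormal k) :=
      iIndepFun_pi (μ := fun _ : Fin k => gaussianReal 0 1) (X := fun _ => r)
        fun _ => hr.aemeasurable
    have hsub : ∀ i ∈ (Finset.univ : Finset (Fin k)),
        HasSubgaussianMGF (fun y : Fin k → ℝ => r (y i)) ((‖η - -η‖₊ / 2) ^ 2) (stdNormal k) := by
      intro i _
      refine hasSubgaussianMGF_of_mem_Icc_of_integral_eq_zero
        (hr.comp (measurable_pi_apply i)).aemeasurable
        (Filter.Eventually.of_forall fun y => abs_le.1 (hrη (y i))) ?_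
      have hmp := measurePreserving_eval (fun _ : Fin k => gaussianReal 0 1) i
      have hmap := integral_map (μ := stdNormal k) (φ := Function.eval i) (f := r)
        hmp.measurable.aemeasurable hr.aestronglyMeasurable
      rw [stdNormal, hmp.map_eq, hr0] at hmap
      exact hmap.symm
    have h := HasSubgaussianMGF.measure_sum_ge_le_of_iIndepFun hind hsub ht
    have hc : ∑ _i : Fin k, (((‖η - -η‖₊ / 2) ^ 2 : NNReal) : ℝ) = k * η ^ 2 := by
      rw [Finset.sum_const, Finset.card_univ, Fintype.card_fin, nsmul_eq_mul]
      push_cast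
      rw [Real.norm_eq_abs, div_pow, sq_abs]
      ring
    rw [NNReal.coe_sum, hc] at h
    exact h
  have h1 := one_sided s hs hη h0
  have h2 := one_sided (fun x => -s x) hs.neg (fun x => by rw [abs_neg]; exact hη x)
    (by rw [integral_neg, h0, neg_zero])
  have hsub : {y : Fin k → ℝ | t ≤ |∑ i, s (y i)|} ⊆
      {y | t ≤ ∑ i, s (y i)} ∪ {y | t ≤ ∑ i, -s (y i)} := by
    intro y hy
    rw [Set.mem_ofPred_eq, le_abs] at hy
    simpa only [Finset.sum_neg_distrib] using! hy
  have h3 := (measureReal_mono (μ := stdNormal k) hsub).trans (measureReal_union_le _ _)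
  linarith

/-- `1 + s ≥ exp (s / (1 + s)) ≥ exp (s - 2 s²)` for `|s| ≤ 1/2`. -/
theorem exp_sub_two_mul_sq_le {s : ℝ} (hs : |s| ≤ 1 / 2) :
    Real.exp (s - 2 * s ^ 2) ≤ 1 + s := by
  have h := abs_le.1 hs
  have hpos : 0 < 1 + s := by linarith
  rw [← Real.le_log_iff_exp_le hpos]
  refine le_trans ?_ (Real.one_sub_inv_le_log_of_pos hpos)
  have h1 : 1 - (1 + s)⁻¹ = s / (1 + s) := by field_simp; ring
  rw [h1, le_div_iff₀ hpos]
  nlinarith [mul_nonneg (sq_nonneg s) (by linarith : 0 ≤ 1 + 2 * s)]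

theorem abs_prod_one_add_sub_one_le {s : Fin k → ℝ} {η t : ℝ} (hη : ∀ i, |s i| ≤ η)
    (hη2 : η ≤ 1 / 2) (ht1 : t ≤ 1) (ht : |∑ i, s i| ≤ t) :
    |∏ i, (1 + s i) - 1| ≤ 2 * t + 2 * k * η ^ 2 := by
  have ht0 : 0 ≤ t := (abs_nonneg _).trans ht
  have hkη : 0 ≤ (k : ℝ) * η ^ 2 := by positivity
  have hup : ∏ i, (1 + s i) ≤ Real.exp t := by
    calc ∏ i, (1 + s i) ≤ ∏ i, Real.exp (s i) := by
          refine Finset.prod_le_prod (fun i _ => ?_) fun i _ => ?_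
          · have := (abs_le.1 (hη i)).1
            linarith
          · linarith [Real.add_one_le_exp (s i)]
      _ = Real.exp (∑ i, s i) := (Real.exp_sum _ _).symm
      _ ≤ Real.exp t := Real.exp_le_exp.2 ((le_abs_self _).trans ht)
  have hlow : Real.exp (-t - 2 * (k * η ^ 2)) ≤ ∏ i, (1 + s i) := by
    calc Real.exp (-t - 2 * (k * η ^ 2)) ≤ Real.exp (∑ i, (s i - 2 * s i ^ 2)) := by
          refine Real.exp_le_exp.2 ?_
          rw [Finset.sum_sub_distrib, ← Finset.mul_sum]
          have h1 : ∑ i, s i ^ 2 ≤ ∑ _i : Fin k, η ^ 2 :=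
            Finset.sum_le_sum fun i _ => sq_le_sq' (abs_le.1 (hη i)).1 (abs_le.1 (hη i)).2
          rw [Finset.sum_const, Finset.card_univ, Fintype.card_fin, nsmul_eq_mul] at h1
          have h2 := (abs_le.1 ht).1
          linarith
      _ = ∏ i, Real.exp (s i - 2 * s i ^ 2) := Real.exp_sum _ _
      _ ≤ ∏ i, (1 + s i) := Finset.prod_le_prod (fun i _ => (Real.exp_pos _).le)
          fun i _ => exp_sub_two_mul_sq_le ((hη i).trans hη2)
  have h3 : Real.exp t ≤ 1 + 2 * t := by
    have := Real.abs_exp_sub_one_le (x := t) (by rwa [abs_of_nonneg ht0])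
    rw [abs_of_nonneg ht0] at this
    linarith [le_abs_self (Real.exp t - 1)]
  have h4 := Real.add_one_le_exp (-t - 2 * (k * η ^ 2))
  rw [abs_le]
  constructor <;> linarith

theorem abs_prod_one_add_sub_one_le_exp {s : Fin k → ℝ} {η : ℝ} (hη0 : 0 ≤ η)
    (hη : ∀ i, |s i| ≤ η) (hη2 : η ≤ 1 / 2) :
    |∏ i, (1 + s i) - 1| ≤ Real.exp (k * η) := by
  have hup : ∏ i, (1 + s i) ≤ Real.exp (k * η) := by
    calc ∏ i, (1 + s i) ≤ ∏ _i : Fin k, Real.exp η := by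
          refine Finset.prod_le_prod (fun i _ => ?_) fun i _ => ?_
          · have := (abs_le.1 (hη i)).1
            linarith
          · linarith [Real.add_one_le_exp η, (abs_le.1 (hη i)).2]
      _ = Real.exp (k * η) := by
          rw [Finset.prod_const, Finset.card_univ, Fintype.card_fin, ← Real.exp_nat_mul]
  have hlow : 0 ≤ ∏ i, (1 + s i) := Finset.prod_nonneg fun i _ => by
    have := (abs_le.1 (hη i)).1
    linarith
  have h1 : 1 ≤ Real.exp (k * η) := Real.one_le_exp (by positivity)
  rw [abs_le]
  constructor <;> linarith

theorem card_filter_card_le (hk : 1 ≤ k) (d : ℕ) :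
    (((Finset.univ : Finset (Finset (Fin k))).filter (fun S => S.card ≤ d)).card : ℝ) ≤
      ((d : ℝ) + 1) * (k : ℝ) ^ d := by
  have hsub : (Finset.univ : Finset (Finset (Fin k))).filter (fun S => S.card ≤ d) ⊆
      (Finset.range (d + 1)).biUnion fun j => Finset.powersetCard j Finset.univ := by
    intro S hS
    simp only [Finset.mem_filter, Finset.mem_univ, true_and] at hS
    simp only [Finset.mem_biUnion, Finset.mem_range, Finset.mem_powersetCard]
    exact ⟨S.card, by omega, Finset.subset_univ _, rfl⟩
  have h1 : ((Finset.univ : Finset (Finset (Fin k))).filter (fun S => S.card ≤ d)).card ≤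
      (d + 1) * k ^ d := by
    refine (Finset.card_le_card hsub).trans (Finset.card_biUnion_le.trans ?_)
    calc ∑ j ∈ Finset.range (d + 1), (Finset.powersetCard j (Finset.univ : Finset (Fin k))).card
        ≤ ∑ _j ∈ Finset.range (d + 1), k ^ d := by
          refine Finset.sum_le_sum fun j hj => ?_
          rw [Finset.card_powersetCard, Finset.card_univ, Fintype.card_fin]
          exact (Nat.choose_le_pow k j).trans
            (Nat.pow_le_pow_right hk (Nat.lt_succ_iff.1 (Finset.mem_range.1 hj)))
      _ = (d + 1) * k ^ d := by rw [Finset.sum_const, Finset.card_range, smul_eq_mul]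
  exact_mod_cast h1

/-- The weight `kernelBound` has a small integral over a very unlikely event. The parameter `τ`
comes from `1_E X ≤ τ 1_E + X² / τ`. -/
theorem setIntegral_kernelBound_le (hk : 1 ≤ k) {A : ℝ} (hA : 1 ≤ A) (d : ℕ)
    {E : Set (Fin k → ℝ)} (hE : MeasurableSet E) {τ : ℝ} (hτ : 0 < τ) :
    ∫ y in E, kernelBound d A y ∂(stdNormal k) ≤
      ((d : ℝ) + 1) * (k : ℝ) ^ d * (τ * (stdNormal k).real E +
        ((2 * A * d.factorial) ^ 2 * gaussianExpMoment) ^ d / τ) := by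
  set V : ℝ := (2 * A * d.factorial) ^ 2 * gaussianExpMoment with hV
  have hV1 : 1 ≤ V := by
    have h1 : (1 : ℝ) ≤ d.factorial := by exact_mod_cast d.factorial_pos
    have h2 : (1 : ℝ) ≤ 2 * A * d.factorial := by nlinarith
    exact one_le_mul_of_one_le_of_one_le (one_le_pow₀ h2) one_le_gaussianExpMoment
  obtain ⟨hi2, hle2⟩ := integral_mul_one_add_abs_pow_add_one_sq_le hA d
  have key : ∀ S ∈ (Finset.univ : Finset (Finset (Fin k))).filter (fun S => S.card ≤ d),
      ∫ y in E, ∏ i ∈ S, (A * (1 + |y i|) ^ d + 1) ∂(stdNormal k) ≤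
        τ * (stdNormal k).real E + V ^ d / τ := by
    intro S hS
    have hcard : S.card ≤ d := (Finset.mem_filter.1 hS).2
    have hsq : ∀ y : Fin k → ℝ, (∏ i ∈ S, (A * (1 + |y i|) ^ d + 1)) ^ 2 =
        ∏ i, (fun t => if i ∈ S then (A * (1 + |t|) ^ d + 1) ^ 2 else 1) (y i) := by
      intro y
      simp only
      rw [Finset.prod_ite_mem, Finset.univ_inter, Finset.prod_pow]
    have hsqi : Integrable
        (fun y : Fin k → ℝ => (∏ i ∈ S, (A * (1 + |y i|) ^ d + 1)) ^ 2) (stdNormal k) := by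
      simp only [hsq]
      refine integrable_stdNormal_prod (k := k)
        (f := fun i t => if i ∈ S then (A * (1 + |t|) ^ d + 1) ^ 2 else 1) fun i => ?_
      by_cases hi : i ∈ S
      · simpa only [hi, if_true] using hi2
      · simpa only [hi, if_false] using integrable_const _
    have hint : ∫ y : Fin k → ℝ, (∏ i ∈ S, (A * (1 + |y i|) ^ d + 1)) ^ 2 ∂(stdNormal k)
        ≤ V ^ d := by
      simp only [hsq]
      refine (integral_stdNormal_prod fun i t =>
        if i ∈ S then (A * (1 + |t|) ^ d + 1) ^ 2 else 1).trans_le ?_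
      calc ∏ i : Fin k, ∫ t, (if i ∈ S then (A * (1 + |t|) ^ d + 1) ^ 2 else 1)
            ∂(gaussianReal 0 1) ≤ ∏ i : Fin k, if i ∈ S then V else 1 := by
            refine Finset.prod_le_prod (fun i _ => integral_nonneg fun t => ?_) fun i _ => ?_
            · simp only [Pi.zero_apply]
              split_ifs <;> positivity
            · by_cases hi : i ∈ S
              · simpa only [hi, if_true] using hle2
              · simp [hi]
        _ = V ^ S.card := by rw [Finset.prod_ite_mem, Finset.univ_inter, Finset.prod_const]
        _ ≤ V ^ d := pow_le_pow_right₀ hV1 hcard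
    rw [← integral_indicator hE]
    have hE1 : Integrable (E.indicator fun _ => (1 : ℝ)) (stdNormal k) :=
      (integrable_const _).indicator hE
    calc ∫ y, E.indicator (fun y : Fin k → ℝ => ∏ i ∈ S, (A * (1 + |y i|) ^ d + 1)) y
          ∂(stdNormal k)
        ≤ ∫ y, (τ * E.indicator (fun _ => (1 : ℝ)) y +
            (∏ i ∈ S, (A * (1 + |y i|) ^ d + 1)) ^ 2 * τ⁻¹) ∂(stdNormal k) := by
          refine integral_mono ((integrable_prod_finset_kernelBound A d S).indicator hE)
            ((hE1.const_mul τ).add (hsqi.mul_const _)) fun y => ?_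
          simp only
          set X := ∏ i ∈ S, (A * (1 + |y i|) ^ d + 1)
          have hX : 0 ≤ X ^ 2 * τ⁻¹ := by positivity
          by_cases hy : y ∈ E
          · rw [Set.indicator_of_mem hy, Set.indicator_of_mem hy]
            have h1 : 0 ≤ (τ - X) ^ 2 * τ⁻¹ := by positivity
            have h2 : (τ - X) ^ 2 * τ⁻¹ = τ - 2 * X + X ^ 2 * τ⁻¹ := by field_simp; ring
            have h3 : 0 ≤ X ∨ X ≤ 0 := le_total 0 X
            rcases h3 with h3 | h3 <;> linarith
          · rw [Set.indicator_of_notMem hy, Set.indicator_of_notMem hy]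
            linarith
      _ = τ * (stdNormal k).real E +
          (∫ y : Fin k → ℝ, (∏ i ∈ S, (A * (1 + |y i|) ^ d + 1)) ^ 2 ∂(stdNormal k)) * τ⁻¹ := by
          rw [integral_add (hE1.const_mul τ) (hsqi.mul_const _), integral_const_mul,
            integral_mul_const, integral_indicator hE]
          simp
      _ ≤ τ * (stdNormal k).real E + V ^ d / τ := by
          rw [div_eq_mul_inv]
          gcongr
  calc ∫ y in E, kernelBound d A y ∂(stdNormal k)
      = ∑ S ∈ (Finset.univ : Finset (Finset (Fin k))).filter (fun S => S.card ≤ d),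
          ∫ y in E, ∏ i ∈ S, (A * (1 + |y i|) ^ d + 1) ∂(stdNormal k) := by
        unfold kernelBound
        exact integral_finsetSum _ fun S _ =>
          (integrable_prod_finset_kernelBound A d S).integrableOn
    _ ≤ ∑ S ∈ (Finset.univ : Finset (Finset (Fin k))).filter (fun S => S.card ≤ d),
          (τ * (stdNormal k).real E + V ^ d / τ) := Finset.sum_le_sum key
    _ ≤ _ := by
        rw [Finset.sum_const, nsmul_eq_mul]
        exact mul_le_mul_of_nonneg_right (card_filter_card_le hk d) (by positivity)

/-- A product `∏ (1 + s(yᵢ)) - 1` of mean-zero perturbations is small except on an exponentially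
unlikely event; replacing it there by a bounded function with the same low-degree moments yields a
function that is small everywhere. -/
theorem exists_bounded_moment_match_prod (hk : 1 ≤ k) {d : ℕ} {A : ℝ} {κ : ℝ → ℝ → ℝ}
    (hκ : IsReproducingKernel d A κ) (hA : 1 ≤ A) {s : ℝ → ℝ} (hs : Measurable s) {η t τ : ℝ}
    (hη : ∀ x, |s x| ≤ η) (hη2 : η ≤ 1 / 2) (h0 : ∫ x, s x ∂(gaussianReal 0 1) = 0)
    (ht0 : 0 ≤ t) (ht1 : t ≤ 1) (hτ : 0 < τ) :
    ∃ F : (Fin k → ℝ) → ℝ, Measurable F ∧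
      (∀ x, |F x| ≤ 2 * t + 2 * k * η ^ 2 + Real.exp (k * η) * (((d : ℝ) + 1) * (k : ℝ) ^ d *
        (τ * (2 * Real.exp (-t ^ 2 / (2 * (k * η ^ 2)))) +
          ((2 * A * d.factorial) ^ 2 * gaussianExpMoment) ^ d / τ))) ∧
      ∀ a : Fin k → ℕ, ∑ i, a i ≤ d → ∫ x, F x * ∏ i, x i ^ a i ∂(stdNormal k) =
        ∫ x, (∏ i, (1 + s (x i)) - 1) * ∏ i, x i ^ a i ∂(stdNormal k) := by
  have hη0 : 0 ≤ η := (abs_nonneg _).trans (hη 0)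
  set G : (Fin k → ℝ) → ℝ := fun x => ∏ i, (1 + s (x i)) - 1 with hG
  have hGm : Measurable G := by fun_prop
  set E : Set (Fin k → ℝ) := {y | t ≤ |∑ i, s (y i)|} with hE
  have hEm : MeasurableSet E := measurableSet_le measurable_const (by fun_prop)
  have hGb : ∀ x, |G x| ≤ Real.exp (k * η) := fun x =>
    abs_prod_one_add_sub_one_le_exp hη0 (fun i => hη (x i)) hη2
  have hRm : Measurable (E.indicator G) := hGm.indicator hEm
  have hRb : ∀ x, |E.indicator G x| ≤ Real.exp (k * η) := by
    intro x
    by_cases hx : x ∈ E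
    · rw [Set.indicator_of_mem hx]
      exact hGb x
    · rw [Set.indicator_of_notMem hx, abs_zero]
      positivity
  obtain ⟨F, hFm, hFb, hFi⟩ := hκ.exists_bounded_moment_match_pi hRm hRb
  have hB0 : ∀ y : Fin k → ℝ, 0 ≤ kernelBound d A y := fun y =>
    (abs_nonneg _).trans (abs_truncatedKernel_le hκ 0 y)
  have hint : ∫ y, |E.indicator G y| * kernelBound d A y ∂(stdNormal k) ≤
      Real.exp (k * η) * (((d : ℝ) + 1) * (k : ℝ) ^ d *
        (τ * (2 * Real.exp (-t ^ 2 / (2 * (k * η ^ 2)))) +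
          ((2 * A * d.factorial) ^ 2 * gaussianExpMoment) ^ d / τ)) := by
    calc ∫ y, |E.indicator G y| * kernelBound d A y ∂(stdNormal k)
        ≤ ∫ y, Real.exp (k * η) * E.indicator (kernelBound d A) y ∂(stdNormal k) := by
          have hr : Integrable (fun y => Real.exp (k * η) * E.indicator (kernelBound d A) y)
              (stdNormal k) := ((integrable_kernelBound A d).indicator hEm).const_mul _
          have hpt : ∀ y, |E.indicator G y| * kernelBound d A y ≤
              Real.exp (k * η) * E.indicator (kernelBound d A) y := by
            intro y
            by_cases hy : y ∈ E
            · rw [Set.indicator_of_mem hy, Set.indicator_of_mem hy]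
              exact mul_le_mul_of_nonneg_right (hGb y) (hB0 y)
            · rw [Set.indicator_of_notMem hy, Set.indicator_of_notMem hy]
              simp
          refine integral_mono (hr.mono' (hRm.abs.aestronglyMeasurable.mul
            (integrable_kernelBound A d).aestronglyMeasurable)
            (Filter.Eventually.of_forall fun y => ?_)) hr hpt
          rw [Real.norm_of_nonneg (mul_nonneg (abs_nonneg _) (hB0 y))]
          exact hpt y
      _ = Real.exp (k * η) * ∫ y in E, kernelBound d A y ∂(stdNormal k) := by
          rw [integral_const_mul, integral_indicator hEm]
      _ ≤ _ := by
          refine mul_le_mul_of_nonneg_left ((setIntegral_kernelBound_le hk hA d hEm hτ).trans ?_)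
            (Real.exp_pos _).le
          have := stdNormal_real_le_abs_sum (k := k) hs hη h0 ht0
          gcongr
  refine ⟨fun x => Eᶜ.indicator G x + F x, (hGm.indicator hEm.compl).add hFm, ?_, ?_⟩
  · intro x
    refine (abs_add_le _ _).trans (add_le_add ?_ ((hFb x).trans hint))
    by_cases hx : x ∈ Eᶜ
    · rw [Set.indicator_of_mem hx]
      have hx' : |∑ i, s (x i)| ≤ t := le_of_not_ge fun h => hx h
      exact abs_prod_one_add_sub_one_le (fun i => hη (x i)) hη2 ht1 hx'
    · rw [Set.indicator_of_notMem hx, abs_zero]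
      positivity
  · intro a ha
    have hcb : ∀ x, |Eᶜ.indicator G x| ≤ Real.exp (k * η) := by
      intro x
      by_cases hx : x ∈ Eᶜ
      · rw [Set.indicator_of_mem hx]
        exact hGb x
      · rw [Set.indicator_of_notMem hx, abs_zero]
        positivity
    simp only [add_mul]
    rw [integral_add (integrable_mul_monomial (hGm.indicator hEm.compl) hcb a)
      (integrable_mul_monomial hFm hFb a), hFi a ha,
      ← integral_add (integrable_mul_monomial (hGm.indicator hEm.compl) hcb a)
      (integrable_mul_monomial hRm hRb a)]
    congr 1
    funext x
    rw [← add_mul, Set.indicator_compl_add_self_apply]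

end Products

/-! ### The cube -/

section Cube

variable {k : ℕ}

theorem measurable_cube (k : ℕ) : Measurable (cube k) := by
  refine Measurable.ite ?_ measurable_const measurable_const
  exact measurableSet_le measurable_const (measurable_const.sub measurable_norm)

theorem cube_eq_or (k : ℕ) (y : Fin k → ℝ) : cube k y = 1 ∨ cube k y = -1 := by
  unfold cube pmSign
  split_ifs <;> simp

theorem abs_cube (k : ℕ) (y : Fin k → ℝ) : |cube k y| = 1 := by
  rcases cube_eq_or k y with h | h <;> simp [h]

/-- The indicator of the interval `[-θ_k, θ_k]`, whose `k`-fold product is the indicator of the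
cube. -/
noncomputable def cubeFactor (k : ℕ) : ℝ → ℝ :=
  (Set.Icc (-cubeThreshold k) (cubeThreshold k)).indicator fun _ => 1

theorem measurable_cubeFactor (k : ℕ) : Measurable (cubeFactor k) :=
  measurable_const.indicator measurableSet_Icc

theorem cubeFactor_eq_or (k : ℕ) (x : ℝ) : cubeFactor k x = 0 ∨ cubeFactor k x = 1 := by
  by_cases hx : x ∈ Set.Icc (-cubeThreshold k) (cubeThreshold k)
  · exact Or.inr (Set.indicator_of_mem hx _)
  · exact Or.inl (Set.indicator_of_notMem hx _)

theorem integrable_cubeFactor (k : ℕ) : Integrable (cubeFactor k) (gaussianReal 0 1) :=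
  (integrable_const _).indicator measurableSet_Icc

theorem cube_eq_two_mul_prod_sub_one (hk : 1 ≤ k) (y : Fin k → ℝ) :
    cube k y = 2 * ∏ i, cubeFactor k (y i) - 1 := by
  have hθ := (cubeThreshold_unique hk).1.1
  unfold cube pmSign
  by_cases h : ‖y‖ ≤ cubeThreshold k
  · have hmem : ∀ i, y i ∈ Set.Icc (-cubeThreshold k) (cubeThreshold k) := fun i =>
      abs_le.1 ((pi_norm_le_iff_of_nonneg hθ).1 h i)
    have h1 : ∏ i, cubeFactor k (y i) = 1 := Finset.prod_eq_one fun i _ =>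
      Set.indicator_of_mem (hmem i) _
    rw [if_pos (sub_nonneg.2 h), h1]
    norm_num
  · have h1 : ∏ i, cubeFactor k (y i) = 0 := by
      rw [pi_norm_le_iff_of_nonneg hθ] at h
      push Not at h
      obtain ⟨i, hi⟩ := h
      refine Finset.prod_eq_zero (Finset.mem_univ i) (Set.indicator_of_notMem (fun hm => ?_) _)
      exact absurd (abs_le.2 hm) (not_le.2 hi)
    rw [if_neg (by linarith [not_le.1 h]), h1]
    norm_num

/-- The Gaussian mass `q = 2 ^ (-1 / k)` of `[-θ_k, θ_k]`. -/
noncomputable def cubeFactorMass (k : ℕ) : ℝ := ∫ x, cubeFactor k x ∂(gaussianReal 0 1)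

theorem cubeFactorMass_pow (hk : 1 ≤ k) : cubeFactorMass k ^ k = 1 / 2 := by
  have h1 : ∫ y, ∏ i, cubeFactor k (y i) ∂(stdNormal k) = cubeFactorMass k ^ k := by
    rw [integral_stdNormal_prod fun _ => cubeFactor k, Finset.prod_const, Finset.card_univ,
      Fintype.card_fin, cubeFactorMass]
  have h2 := integral_cube (k := k) hk
  simp only [cube_eq_two_mul_prod_sub_one hk] at h2
  rw [integral_sub ((integrable_stdNormal_prod fun _ => integrable_cubeFactor k).const_mul 2)
    (integrable_const _), integral_const_mul, h1] at h2
  simp only [integral_const, probReal_univ, smul_eq_mul, mul_one] at h2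
  linarith

theorem cubeFactorMass_nonneg (k : ℕ) : 0 ≤ cubeFactorMass k :=
  integral_nonneg fun x => by
    rcases cubeFactor_eq_or k x with h | h <;> simp [h]

theorem cubeFactorMass_le_one (k : ℕ) : cubeFactorMass k ≤ 1 := by
  have h : cubeFactorMass k ≤ ∫ _ : ℝ, (1 : ℝ) ∂(gaussianReal 0 1) := by
    refine integral_mono (integrable_cubeFactor k) (integrable_const _) fun x => ?_
    rcases cubeFactor_eq_or k x with h | h <;> simp [h]
  simpa using h

theorem half_le_cubeFactorMass (hk : 1 ≤ k) : 1 / 2 ≤ cubeFactorMass k := by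
  rw [← cubeFactorMass_pow hk]
  exact pow_le_of_le_one (cubeFactorMass_nonneg k) (cubeFactorMass_le_one k) (by omega)

/-- `1 - 2 ^ (-1 / k) ≤ 1 / k`, because `(1 - 1 / k) ^ k ≤ 1 / e < 1 / 2`. -/
theorem one_sub_cubeFactorMass_le (hk : 1 ≤ k) : 1 - cubeFactorMass k ≤ 1 / k := by
  by_contra! hlt
  have hk0 : (0 : ℝ) < k := by exact_mod_cast hk
  have h1 : cubeFactorMass k ≤ Real.exp (-(1 / k)) := by
    have := Real.add_one_le_exp (-(1 / (k : ℝ)))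
    linarith
  have h2 := pow_le_pow_left₀ (cubeFactorMass_nonneg k) h1 k
  rw [cubeFactorMass_pow hk, ← Real.exp_nat_mul, mul_neg, mul_one_div_cancel hk0.ne'] at h2
  have h3 := Real.exp_neg_one_lt_d9
  linarith

theorem integral_abs_cubeFactor_sub_le (hk : 1 ≤ k) :
    ∫ x, |cubeFactor k x - cubeFactorMass k| ∂(gaussianReal 0 1) ≤ 2 / k := by
  have hq0 := cubeFactorMass_nonneg k
  have hq1 := cubeFactorMass_le_one k
  have h : ∀ x, |cubeFactor k x - cubeFactorMass k| =
      (1 - 2 * cubeFactorMass k) * cubeFactor k x + cubeFactorMass k := by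
    intro x
    rcases cubeFactor_eq_or k x with h | h
    · rw [h, zero_sub, abs_neg, abs_of_nonneg hq0]
      ring
    · rw [h, abs_of_nonneg (by linarith)]
      ring
  simp only [h]
  rw [integral_add ((integrable_cubeFactor k).const_mul _) (integrable_const _),
    integral_const_mul, ← cubeFactorMass]
  simp only [integral_const, probReal_univ, smul_eq_mul, one_mul]
  have h1 := one_sub_cubeFactorMass_le hk
  have h2 : (2 : ℝ) / k = 2 * (1 / k) := by ring
  nlinarith

theorem abs_cubeFactor_sub_le_one (x : ℝ) : |cubeFactor k x - cubeFactorMass k| ≤ 1 := by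
  have hq0 := cubeFactorMass_nonneg k
  have hq1 := cubeFactorMass_le_one k
  rw [abs_le]
  rcases cubeFactor_eq_or k x with h | h <;> rw [h] <;> constructor <;> linarith

/-- Resilience from a small function `F` with the low-degree moments of the cube:
`(cube - F) / (1 + ε)` is `[-1, 1]`-valued, orthogonal to low-degree polynomials, and within `2 ε`
of the cube. -/
theorem isApproxResilient_cube_of_moment_match {d : ℕ} {α ε : ℝ} {F : (Fin k → ℝ) → ℝ}
    (hF : Measurable F) (hε : ∀ x, |F x| ≤ ε) (hα : 2 * ε ≤ α) (hα1 : α < 1)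
    (hm : ∀ a : Fin k → ℕ, ∑ i, a i ≤ d → ∫ x, F x * ∏ i, x i ^ a i ∂(stdNormal k) =
      ∫ x, cube k x * ∏ i, x i ^ a i ∂(stdNormal k)) :
    IsApproxResilient α d (cube k) := by
  have hε0 : 0 ≤ ε := (abs_nonneg _).trans (hε 0)
  have hε1 : 0 < 1 + ε := by linarith
  have hcm := measurable_cube k
  have hc : ∀ x, |cube k x| ≤ 1 := fun x => (abs_cube k x).le
  set g : (Fin k → ℝ) → ℝ := fun x => (cube k x - F x) / (1 + ε) with hg
  have hgm : Measurable g := (hcm.sub hF).div_const _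
  have hgb : ∀ x, |g x| ≤ 1 := by
    intro x
    rw [hg, abs_div, abs_of_pos hε1, div_le_one hε1]
    exact (abs_sub _ _).trans (add_le_add (hc x) (hε x))
  refine ⟨⟨by linarith, hα1⟩, hcm, fun x => abs_le.1 (hc x), g,
    ⟨hgm, fun x => abs_le.1 (hgb x), ?_⟩, ?_⟩
  · refine integral_mul_eval_eq_zero_of_monomial hgm hgb fun a ha => ?_
    have h1 : (fun x : Fin k → ℝ => g x * ∏ i, x i ^ a i) = fun x =>
        (1 + ε)⁻¹ * (cube k x * ∏ i, x i ^ a i - F x * ∏ i, x i ^ a i) := by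
      funext x
      simp only [hg]
      ring
    rw [h1, integral_const_mul, integral_sub (integrable_mul_monomial hcm hc a)
      (integrable_mul_monomial hF hε a), hm a ha, sub_self, mul_zero]
  · have hpt : ∀ x, ‖|cube k x - g x|‖ ≤ 2 * ε := by
      intro x
      have h1 : cube k x - g x = (ε * cube k x + F x) / (1 + ε) := by
        simp only [hg]
        field_simp
        ring
      rw [norm_abs_eq_norm, Real.norm_eq_abs, h1, abs_div, abs_of_pos hε1, div_le_iff₀ hε1]
      have h2 := abs_add_le (ε * cube k x) (F x)
      rw [abs_mul, abs_cube, abs_of_nonneg hε0] at h2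
      nlinarith [hε x]
    have h2 := norm_integral_le_of_norm_le (μ := stdNormal k) (integrable_const (2 * ε))
      (Filter.Eventually.of_forall hpt)
    simp only [integral_const, probReal_univ, smul_eq_mul, one_mul] at h2
    exact ((le_abs_self _).trans h2).trans hα

/-- The quantitative form of the result, with all parameters free: `η` bounds the one-variable
replacement for the indicator of `[-θ_k, θ_k]`, `t` is the deviation allowed in Hoeffding's
inequality, and `L` and `τ` are cut-off levels to be optimized. -/
theorem isApproxResilient_cube_of_bounds (hk : 1 ≤ k) {d : ℕ} {A : ℝ} {κ : ℝ → ℝ → ℝ}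
    (hκ : IsReproducingKernel d A κ) (hA : 1 ≤ A) {L η t τ α : ℝ} (hL : 0 ≤ L)
    (hη : 2 * A * (L ^ d * (2 / k) + d.factorial * gaussianExpMoment * Real.exp (-L)) ≤ η)
    (hη2 : η ≤ 1 / 2) (ht0 : 0 ≤ t) (ht1 : t ≤ 1) (hτ : 0 < τ)
    (hα : 2 * (2 * t + 2 * k * η ^ 2 + Real.exp (k * η) * (((d : ℝ) + 1) * (k : ℝ) ^ d *
        (τ * (2 * Real.exp (-t ^ 2 / (2 * (k * η ^ 2)))) +
          ((2 * A * d.factorial) ^ 2 * gaussianExpMoment) ^ d / τ))) ≤ α) (hα1 : α < 1) :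
    IsApproxResilient α d (cube k) := by
  have hq := half_le_cubeFactorMass hk
  have hq0 : 0 < cubeFactorMass k := by linarith
  set q := cubeFactorMass k with hqdef
  have hwm : Measurable fun x => cubeFactor k x - q := (measurable_cubeFactor k).sub_const _
  obtain ⟨s₀, hs₀m, hs₀b, hs₀i⟩ :=
    hκ.exists_bounded_moment_match hwm fun x => abs_cubeFactor_sub_le_one x
  have hη0 : ∀ x, |s₀ x| ≤ η / 2 := by
    intro x
    have h1 := integral_abs_mul_one_add_abs_pow_le hwm (fun x => abs_cubeFactor_sub_le_one x) d hL
    have h2 := mul_le_mul_of_nonneg_left (integral_abs_cubeFactor_sub_le hk) (pow_nonneg hL d)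
    have h3 := (hs₀b x).trans (mul_le_mul_of_nonneg_left (h1.trans (add_le_add_left h2 _))
      (by linarith : 0 ≤ A))
    linarith
  have hηb : ∀ x, |s₀ x / q| ≤ η := by
    intro x
    rw [abs_div, abs_of_pos hq0, div_le_iff₀ hq0]
    have h1 := hη0 x
    nlinarith [abs_nonneg (s₀ x)]
  have hwi : ∀ i, Integrable (fun x => x ^ i * cubeFactor k x) (gaussianReal 0 1) := fun i =>
    (integrable_abs_pow_gaussian i).mono'
      ((measurable_id.pow_const i).mul (measurable_cubeFactor k)).aestronglyMeasurable
      (Filter.Eventually.of_forall fun x => by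
        rw [norm_mul, norm_pow, Real.norm_eq_abs]
        rcases cubeFactor_eq_or k x with h | h <;> simp [h])
  have hs₀int : ∀ i, Integrable (fun x => x ^ i * s₀ x) (gaussianReal 0 1) := fun i =>
    ((integrable_abs_pow_gaussian i).mul_const (η / 2)).mono'
      ((measurable_id.pow_const i).mul hs₀m).aestronglyMeasurable
      (Filter.Eventually.of_forall fun x => by
        rw [norm_mul, norm_pow, Real.norm_eq_abs, Real.norm_eq_abs]
        exact mul_le_mul_of_nonneg_left (hη0 x) (by positivity))
  have hmom : ∀ i ≤ d, ∫ x, x ^ i * (1 + s₀ x / q) ∂(gaussianReal 0 1) =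
      q⁻¹ * ∫ x, x ^ i * cubeFactor k x ∂(gaussianReal 0 1) := by
    intro i hi
    have h1 : (fun x => x ^ i * (1 + s₀ x / q)) = fun x => q⁻¹ * (q * x ^ i + x ^ i * s₀ x) := by
      funext x
      field_simp
    rw [h1, integral_const_mul, integral_add ((integrable_pow_gaussian i).const_mul q) (hs₀int i),
      hs₀i i hi]
    simp only [mul_sub]
    rw [integral_sub (hwi i) ((integrable_pow_gaussian i).mul_const q), integral_const_mul,
      integral_mul_const]
    ring
  have h0 : ∫ x, s₀ x / q ∂(gaussianReal 0 1) = 0 := by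
    have h1 := hs₀i 0 (Nat.zero_le d)
    simp only [pow_zero, one_mul] at h1
    rw [integral_div, h1, integral_sub (integrable_cubeFactor k) (integrable_const _),
      ← cubeFactorMass]
    simp [← hqdef]
  obtain ⟨F, hFm, hFb, hFi⟩ := exists_bounded_moment_match_prod hk hκ hA (hs₀m.div_const q) hηb
    hη2 h0 ht0 ht1 hτ
  refine isApproxResilient_cube_of_moment_match hFm hFb hα hα1 fun a ha => ?_
  rw [hFi a ha]
  have hai : ∀ i, a i ≤ d := fun i =>
    (Finset.single_le_sum (fun _ _ => Nat.zero_le _) (Finset.mem_univ i)).trans ha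
  have hone : ∀ i : Fin k, Integrable (fun x : ℝ => x ^ a i * (1 + s₀ x / q))
      (gaussianReal 0 1) := fun i =>
    ((integrable_pow_gaussian (a i)).add ((hs₀int (a i)).mul_const q⁻¹)).congr
      (Filter.Eventually.of_forall fun x => by simp only [Pi.add_apply]; ring)
  have hmon := integrable_stdNormal_prod (k := k) (f := fun i x => x ^ a i)
    fun i => integrable_pow_gaussian (a i)
  have hl : ∀ x : Fin k → ℝ, (∏ i, (1 + s₀ (x i) / q) - 1) * ∏ i, x i ^ a i =
      ∏ i, (fun t => t ^ a i * (1 + s₀ t / q)) (x i) - ∏ i, (fun t => t ^ a i) (x i) := by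
    intro x
    simp only
    rw [Finset.prod_mul_distrib]
    ring
  have hr : ∀ x : Fin k → ℝ, cube k x * ∏ i, x i ^ a i =
      2 * ∏ i, (fun t => t ^ a i * cubeFactor k t) (x i) - ∏ i, (fun t => t ^ a i) (x i) := by
    intro x
    simp only
    rw [cube_eq_two_mul_prod_sub_one hk, Finset.prod_mul_distrib]
    ring
  simp only [hl, hr]
  rw [integral_sub (integrable_stdNormal_prod hone) hmon,
    integral_sub ((integrable_stdNormal_prod fun i => hwi (a i)).const_mul 2) hmon,
    integral_const_mul, integral_stdNormal_prod fun i t => t ^ a i * (1 + s₀ t / q),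
    integral_stdNormal_prod fun i t => t ^ a i * cubeFactor k t]
  congr 1
  -- The normalizations agree because `q ^ k = 1 / 2`.
  rw [Finset.prod_congr rfl fun i _ => hmom (a i) (hai i), Finset.prod_mul_distrib,
    Finset.prod_const, Finset.card_univ, Fintype.card_fin, inv_pow, hqdef, cubeFactorMass_pow hk]
  norm_num

end Cube

/-! ### Choice of parameters -/

theorem eventually_mul_log_pow_le_rpow (C : ℝ) (n : ℕ) {r : ℝ} (hr : 0 < r) :
    ∀ᶠ x : ℝ in Filter.atTop, C * Real.log x ^ n ≤ x ^ r := by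
  have h := (isLittleO_log_rpow_rpow_atTop (n : ℝ) hr).bound
    (show (0 : ℝ) < (|C| + 1)⁻¹ by positivity)
  filter_upwards [h, Filter.eventually_ge_atTop (1 : ℝ)] with x hx hx1
  have hl : 0 ≤ Real.log x := Real.log_nonneg hx1
  rw [Real.rpow_natCast, Real.norm_of_nonneg (by positivity), Real.norm_of_nonneg (by positivity),
    inv_mul_eq_div, le_div_iff₀ (by positivity)] at hx
  have h1 : C * Real.log x ^ n ≤ |C| * Real.log x ^ n :=
    mul_le_mul_of_nonneg_right (le_abs_self C) (by positivity)
  have h2 : 0 ≤ Real.log x ^ n := by positivity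
  linarith

theorem eventually_large_rpow : ∀ᶠ x : ℝ in Filter.atTop, 3 ≤ Real.log x ∧
    10 * (2 + gaussianExpMoment) * Real.log x ^ 3 ≤ x ^ (1 / 800 : ℝ) ∧
    32 * Real.log x ^ 2 ≤ x ^ (1 / 200 : ℝ) ∧ 14 ≤ x ^ (1 / 400 : ℝ) ∧
    14 ≤ x ^ (1 / 200 : ℝ) := by
  have h0 := Real.tendsto_log_atTop.eventually_ge_atTop 3
  have h1 := eventually_mul_log_pow_le_rpow (10 * (2 + gaussianExpMoment)) 3
    (show (0 : ℝ) < 1 / 800 by norm_num)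
  have h2 := eventually_mul_log_pow_le_rpow 32 2 (show (0 : ℝ) < 1 / 200 by norm_num)
  have h3 := (tendsto_rpow_atTop (show (0 : ℝ) < 1 / 400 by norm_num)).eventually_ge_atTop 14
  have h4 := (tendsto_rpow_atTop (show (0 : ℝ) < 1 / 200 by norm_num)).eventually_ge_atTop 14
  filter_upwards [h0, h1, h2, h3, h4] with x a b c d e using ⟨a, b, c, d, e⟩

/-- If `d ≤ c log x / log log x` then `d + 2 ≤ log x` and `(log x) ^ d ≤ x ^ c`. -/
theorem log_pow_le_rpow {x : ℝ} (hx : 0 < x) (hL : 3 ≤ Real.log x) {d : ℕ}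
    (hd : (d : ℝ) ≤ 1 / 1600 * (Real.log x / Real.log (Real.log x))) :
    (d : ℝ) + 2 ≤ Real.log x ∧ Real.log x ^ d ≤ x ^ (1 / 1600 : ℝ) := by
  have hL0 : 0 < Real.log x := by linarith
  have hLL : 1 ≤ Real.log (Real.log x) := by
    rw [Real.le_log_iff_exp_le hL0]
    have := Real.exp_one_lt_d9
    linarith
  have h1 : (d : ℝ) * Real.log (Real.log x) ≤ 1 / 1600 * Real.log x := by
    rw [mul_div_assoc', le_div_iff₀ (by linarith)] at hd
    exact hd
  have h2 : (d : ℝ) ≤ (d : ℝ) * Real.log (Real.log x) :=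
    le_mul_of_one_le_right (Nat.cast_nonneg d) hLL
  refine ⟨by linarith, ?_⟩
  calc Real.log x ^ d = Real.exp (d * Real.log (Real.log x)) := by
        rw [Real.exp_nat_mul, Real.exp_log hL0]
    _ ≤ Real.exp (Real.log x * (1 / 1600)) := Real.exp_le_exp.2 (by linarith)
    _ = x ^ (1 / 1600 : ℝ) := by rw [Real.rpow_def_of_pos hx]

/-- The error coming from Hoeffding's exceptional set is `O(1 / k)`: the exponential gain
`exp (-x ^ (1 / 200) / 4)` beats every factor `exp (O(log² x))` and the crude bound
`exp (x ^ (1 / 400))`. -/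
theorem exceptional_error_le {x : ℝ} (hx : 0 < x) {d : ℕ} (hd : (d : ℝ) + 2 ≤ Real.log x)
    (hl : 32 * Real.log x ^ 2 ≤ x ^ (1 / 200 : ℝ)) (h14 : 14 ≤ x ^ (1 / 400 : ℝ)) {V : ℝ}
    (hV0 : 0 ≤ V) (hV : V ≤ x) :
    Real.exp (x ^ (1 / 400 : ℝ)) * (((d : ℝ) + 1) * x ^ d *
      (Real.exp (x ^ (1 / 200 : ℝ) / 4) * (2 * Real.exp (-(x ^ (1 / 200 : ℝ) / 2))) +
        V ^ d / Real.exp (x ^ (1 / 200 : ℝ) / 4))) ≤ 3 * x⁻¹ := by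
  set L := Real.log x with hL
  set X := x ^ (1 / 400 : ℝ) with hX
  have hd0 : (0 : ℝ) ≤ d := Nat.cast_nonneg d
  have hXX : x ^ (1 / 200 : ℝ) = X ^ 2 := by
    rw [hX, ← Real.rpow_natCast, ← Real.rpow_mul hx.le]
    norm_num
  rw [hXX] at hl ⊢
  have hxd : x ^ d ≤ Real.exp (L ^ 2) := by
    calc x ^ d = Real.exp (d * L) := by rw [Real.exp_nat_mul, hL, Real.exp_log hx]
      _ ≤ Real.exp (L ^ 2) := Real.exp_le_exp.2 (by nlinarith)
  have hVd : V ^ d ≤ Real.exp (L ^ 2) := (pow_le_pow_left₀ hV0 hV d).trans hxd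
  have hd1 : (d : ℝ) + 1 ≤ Real.exp L := by
    have := Real.add_one_le_exp L
    linarith
  have e1 : Real.exp (X ^ 2 / 4) * (2 * Real.exp (-(X ^ 2 / 2))) =
      2 * Real.exp (-(X ^ 2 / 4)) := by
    rw [mul_left_comm, ← Real.exp_add]
    ring_nf
  have h1 : 1 ≤ Real.exp (L ^ 2) := Real.one_le_exp (by positivity)
  rw [e1, div_eq_mul_inv (V ^ d), ← Real.exp_neg]
  calc Real.exp X * (((d : ℝ) + 1) * x ^ d *
        (2 * Real.exp (-(X ^ 2 / 4)) + V ^ d * Real.exp (-(X ^ 2 / 4))))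
      ≤ Real.exp X * (Real.exp L * Real.exp (L ^ 2) *
        (2 * Real.exp (L ^ 2) * Real.exp (-(X ^ 2 / 4)) +
          Real.exp (L ^ 2) * Real.exp (-(X ^ 2 / 4)))) := by
        have h2 : 2 * Real.exp (-(X ^ 2 / 4)) ≤
            2 * Real.exp (L ^ 2) * Real.exp (-(X ^ 2 / 4)) := by
          have := Real.exp_pos (-(X ^ 2 / 4))
          nlinarith
        gcongr
    _ = 3 * Real.exp (X + L + L ^ 2 + L ^ 2 - X ^ 2 / 4) := by
        rw [sub_eq_add_neg, Real.exp_add, Real.exp_add, Real.exp_add, Real.exp_add]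
        ring
    _ ≤ 3 * Real.exp (-L) := by
        gcongr
        nlinarith
    _ = 3 * x⁻¹ := by rw [Real.exp_neg, hL, Real.exp_log hx]

theorem isApproxResilient_cube_of_large {k d : ℕ} (hk : 1 ≤ k) (hL : 3 ≤ Real.log k)
    (h1 : 10 * (2 + gaussianExpMoment) * Real.log k ^ 3 ≤ (k : ℝ) ^ (1 / 800 : ℝ))
    (h2 : 32 * Real.log k ^ 2 ≤ (k : ℝ) ^ (1 / 200 : ℝ)) (h3 : 14 ≤ (k : ℝ) ^ (1 / 400 : ℝ))
    (h4 : 14 ≤ (k : ℝ) ^ (1 / 200 : ℝ))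
    (hd : (d : ℝ) ≤ 1 / 1600 * (Real.log k / Real.log (Real.log k))) :
    IsApproxResilient ((k : ℝ) ^ (-0.49 : ℝ)) d (cube k) := by
  obtain ⟨κ, hκ⟩ := exists_isReproducingKernel d
  have hx1 : (1 : ℝ) ≤ k := by exact_mod_cast hk
  set x : ℝ := (k : ℝ) with hxdef
  have hx : 0 < x := by linarith
  obtain ⟨hd2, hLd⟩ := log_pow_le_rpow hx hL hd
  set L := Real.log x with hLdef
  have hL0 : 0 < L := by linarith
  have hC1 := one_le_gaussianExpMoment
  set C := gaussianExpMoment with hC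
  have hd0 : (0 : ℝ) ≤ d := Nat.cast_nonneg d
  have hfac : (d.factorial : ℝ) ≤ x ^ (1 / 1600 : ℝ) := by
    have h5 : (d.factorial : ℝ) ≤ (d : ℝ) ^ d := by exact_mod_cast d.factorial_le_pow
    exact (h5.trans (pow_le_pow_left₀ hd0 (by linarith) d)).trans hLd
  set A : ℝ := 5 * ((d : ℝ) + 2) ^ (d + 3) with hA
  have hA1 : 1 ≤ A := by
    have : (1 : ℝ) ≤ ((d : ℝ) + 2) ^ (d + 3) := one_le_pow₀ (by linarith)
    linarith
  have hAle : A ≤ 5 * L ^ 3 * x ^ (1 / 1600 : ℝ) := by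
    have h5 : ((d : ℝ) + 2) ^ (d + 3) ≤ L ^ (d + 3) := pow_le_pow_left₀ (by linarith) hd2 _
    have h6 : L ^ (d + 3) ≤ L ^ 3 * x ^ (1 / 1600 : ℝ) := by
      rw [pow_add, mul_comm]
      gcongr
    linarith
  -- Powers of `x` used below.
  set p := x ^ (1 / 1600 : ℝ) with hp
  have hp0 : 0 < p := Real.rpow_pos_of_pos hx _
  have hp800 : x ^ (1 / 800 : ℝ) = p ^ 2 := by
    rw [hp, ← Real.rpow_natCast, ← Real.rpow_mul hx.le]
    norm_num
  have hp400 : x ^ (1 / 400 : ℝ) = p ^ 4 := by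
    rw [hp, ← Real.rpow_natCast, ← Real.rpow_mul hx.le]
    norm_num
  have hpx : p ^ 1600 = x := by
    rw [hp, ← Real.rpow_natCast, ← Real.rpow_mul hx.le]
    norm_num
  have hp1 : 1 ≤ p := Real.one_le_rpow hx1 (by norm_num)
  rw [hp800] at h1
  have hkη : x * x ^ (-399 / 400 : ℝ) = x ^ (1 / 400 : ℝ) := by
    nth_rewrite 1 [← Real.rpow_one x]
    rw [← Real.rpow_add hx]
    norm_num
  have hη : x ^ (-399 / 400 : ℝ) = p ^ 4 / x := by
    rw [eq_div_iff hx.ne', mul_comm, hkη, hp400]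
  have hkη2 : x * (x ^ (-399 / 400 : ℝ)) ^ 2 = x ^ (-199 / 200 : ℝ) := by
    nth_rewrite 1 [← Real.rpow_one x]
    rw [← Real.rpow_natCast, ← Real.rpow_mul hx.le, ← Real.rpow_add hx]
    norm_num
  have htη : -(x ^ (-99 / 200 : ℝ)) ^ 2 / (2 * (x * (x ^ (-399 / 400 : ℝ)) ^ 2)) =
      -(x ^ (1 / 200 : ℝ) / 2) := by
    have h5 : (x ^ (-99 / 200 : ℝ)) ^ 2 = x ^ (1 / 200 : ℝ) * x ^ (-199 / 200 : ℝ) := by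
      rw [← Real.rpow_natCast, ← Real.rpow_mul hx.le, ← Real.rpow_add hx]
      norm_num
    have h6 : x ^ (-199 / 200 : ℝ) ≠ 0 := (Real.rpow_pos_of_pos hx _).ne'
    rw [hkη2, h5]
    field_simp
  have hV : (2 * A * d.factorial) ^ 2 * C ≤ x := by
    have h5 : 2 * A * d.factorial ≤ p ^ 4 := by
      calc 2 * A * d.factorial ≤ 2 * (5 * L ^ 3 * p) * p := by gcongr
        _ = (10 * 1 * L ^ 3) * p ^ 2 := by ring
        _ ≤ (10 * (2 + C) * L ^ 3) * p ^ 2 := by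
            gcongr
            linarith
        _ ≤ p ^ 2 * p ^ 2 := by gcongr
        _ = p ^ 4 := by ring
    have h6 : C ≤ p ^ 2 := by
      have h7 : (1 : ℝ) ≤ L ^ 3 := one_le_pow₀ (by linarith)
      nlinarith
    calc (2 * A * d.factorial) ^ 2 * C ≤ (p ^ 4) ^ 2 * p ^ 2 := by gcongr
      _ = p ^ 10 := by ring
      _ ≤ p ^ 1600 := pow_le_pow_right₀ hp1 (by norm_num)
      _ = x := hpx
  have hexc := exceptional_error_le hx hd2 h2 h3 (by positivity) hV
  have hneg : ∀ r : ℝ, r ≤ -99 / 200 → x ^ r ≤ x ^ (-99 / 200 : ℝ) := fun r hr =>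
    Real.rpow_le_rpow_of_exponent_le hx1 hr
  refine isApproxResilient_cube_of_bounds hk hκ hA1 hL0.le (η := x ^ (-399 / 400 : ℝ))
    (t := x ^ (-99 / 200 : ℝ)) (τ := Real.exp (x ^ (1 / 200 : ℝ) / 4)) ?_ ?_ (by positivity) ?_
    (Real.exp_pos _) ?_ ?_
  · have hexp : Real.exp (-L) = 1 / x := by
      rw [Real.exp_neg, hLdef, Real.exp_log hx, one_div]
    rw [hexp, hη]
    calc 2 * A * (L ^ d * (2 / x) + d.factorial * C * (1 / x))
        ≤ 2 * (5 * L ^ 3 * p) * (p * (2 / x) + p * C * (1 / x)) := by gcongr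
      _ = (10 * (2 + C) * L ^ 3) * p ^ 2 / x := by ring
      _ ≤ p ^ 2 * p ^ 2 / x := by gcongr
      _ = p ^ 4 / x := by ring
  · have h5 : x ^ (-399 / 400 : ℝ) ≤ x ^ (-1 / 400 : ℝ) :=
      Real.rpow_le_rpow_of_exponent_le hx1 (by norm_num)
    have h6 : x ^ (-1 / 400 : ℝ) = (x ^ (1 / 400 : ℝ))⁻¹ := by
      rw [← Real.rpow_neg hx.le]
      norm_num
    have h7 : (x ^ (1 / 400 : ℝ))⁻¹ ≤ 14⁻¹ := inv_anti₀ (by norm_num) h3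
    rw [h6] at h5
    norm_num at h7 ⊢
    linarith
  · exact Real.rpow_le_one_of_one_le_of_nonpos hx1 (by norm_num)
  · have h5 : 2 * x * (x ^ (-399 / 400 : ℝ)) ^ 2 ≤ 2 * x ^ (-99 / 200 : ℝ) := by
      rw [mul_assoc, hkη2]
      have := hneg (-199 / 200) (by norm_num)
      linarith
    have h6 : x⁻¹ ≤ x ^ (-99 / 200 : ℝ) := by
      rw [← Real.rpow_neg_one]
      exact hneg _ (by norm_num)
    have h7 : x ^ (-0.49 : ℝ) = x ^ (1 / 200 : ℝ) * x ^ (-99 / 200 : ℝ) := by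
      rw [← Real.rpow_add hx]
      norm_num
    have h8 : 14 * x ^ (-99 / 200 : ℝ) ≤ x ^ (1 / 200 : ℝ) * x ^ (-99 / 200 : ℝ) := by
      gcongr
    rw [hkη, htη, h7]
    linarith
  · have hx1' : 1 < x := by
      by_contra! h
      have := Real.log_nonpos hx.le h
      linarith
    exact Real.rpow_lt_one_of_one_lt_of_neg hx1' (by norm_num)

theorem mainTheorem4 :
    ∃ c : ℝ, 0 < c ∧ ∃ K : ℕ, ∀ k : ℕ, K ≤ k →
      ∀ d : ℕ, (d : ℝ) ≤ c * (Real.log k / Real.log (Real.log k)) →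
        IsApproxResilient ((k : ℝ) ^ (-0.49 : ℝ)) d (cube k) := by
  obtain ⟨K, hK⟩ := Filter.eventually_atTop.1
    (tendsto_natCast_atTop_atTop.eventually eventually_large_rpow)
  refine ⟨1 / 1600, by norm_num, max K 1, fun k hk d hd => ?_⟩
  obtain ⟨h0, h1, h2, h3, h4⟩ := hK k ((le_max_left _ _).trans hk)
  exact isApproxResilient_cube_of_large ((le_max_right _ _).trans hk) h0 h1 h2 h3 h4 hd
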